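/- Let $(B,\mathfrak m,k)$ be a local ring which is excellent (Noetherian, universally catenary, a G-ring and J-2), equicharacteristic ($B$ and $k$ have the same characteristic), equidimensional ($\dim B/\mathfrak p=\dim B$ for every minimal prime $\mathfrak p$) and non-reduced, and let $B_{\mathrm{red}}=B/\mathrm{Nil}(B)$. Then $$\mathcal S\text{-}\mathrm{sl}(B)=\mathcal S\text{-}\mathrm{sl}(B_{\mathrm{red}}),$$ and $\mathcal S\text{-}\mathrm{sl}(B)=\infty$ if and only if $B_{\mathrm{red}}$ is a regular local ring. Here, for a Noetherian local ring $(A,\mathfrak n,\kappa)$, the Samuel slope $\mathcal S\text{-}\mathrm{sl}(A)\in\mathbb R_{\ge 0}\cup\{\infty\}$ is defined as follows. For $f\in A$ let $\nu_{\mathfrak n}(f)=\sup\{m\in\mathbb N: f\in\mathfrak n^m\}$ and let $\overline\nu_{\mathfrak n}(f)=\lim_{n\to\infty}\nu_{\mathfrak n}(f^n)/n\in[0,\infty]$ be the asymptotic Samuel function. Put $\mathfrak n^{\ge 1}=\{f\in A:\overline\nu_{\mathfrak n}(f)\ge 1\}$ and $\mathfrak n^{>1}=\{f\in A:\overline\nu_{\mathfrak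 n}(f)>1\}$, let $\lambda_{\mathfrak n}:\mathfrak n/\mathfrak n^2\to\mathfrak n^{\ge 1}/\mathfrak n^{>1}$ be the natural map, and let $t=\dim_\kappa(\mathfrak n/\mathfrak n^2)-\dim A$. If $A$ is regular, then $\mathcal S\text{-}\mathrm{sl}(A)=\infty$. If $A$ is not regular and $\dim_\kappa\ker\lambda_{\mathfrak n}\ne t$, then $\mathcal S\text{-}\mathrm{sl}(A)=1$. If $A$ is not regular and $\dim_\kappa\ker\lambda_{\mathfrak n}=t$, then $$\mathcal S\text{-}\mathrm{sl}(A)=\sup_{\gamma_1,\dots,\gamma_t}\ \min\{\overline\nu_{\mathfrak n}(\gamma_1),\dots,\overline\nu_{\mathfrak n}(\gamma_t)\},$$ the supremum being over all $\gamma_1,\dots,\gamma_t\in\mathfrak n$ whose classes in $\mathfrak n/\mathfrak n^2$ form a basis of $\ker\lambda_{\mathfrak n}$. -/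

import Mathlib

open scoped ENNReal TensorProduct
open Filter Topology IsLocalRing

universe u

/-! ### The asymptotic Samuel function -/

section Samuel

variable {A : Type*} [CommRing A]

/-- The order function of an ideal: `ν_I(f) = sup {m ∈ ℕ ∣ f ∈ I ^ m}`, with values in `[0, ∞]`. -/
noncomputable def idealOrder (I : Ideal A) (f : A) : ℝ≥0∞ :=
  ⨆ (m : ℕ) (_ : f ∈ I ^ m), (m : ℝ≥0∞)

/-- The asymptotic Samuel function `ν̄_I(f) = lim_n ν_I(f ^ n) / n`, with values in `[0, ∞]`.
The limit always exists, see `tendsto_asymptoticSamuel`. -/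
noncomputable def asymptoticSamuel (I : Ideal A) (f : A) : ℝ≥0∞ :=
  limsup (fun n : ℕ => idealOrder I (f ^ n) / (n : ℝ≥0∞)) atTop

theorem le_idealOrder {I : Ideal A} {f : A} {m : ℕ} (h : f ∈ I ^ m) :
    (m : ℝ≥0∞) ≤ idealOrder I f :=
  le_iSup₂_of_le m h le_rfl

theorem pow_mem_pow_mul_div {I : Ideal A} {f : A} {m n : ℕ} (h : f ^ n ∈ I ^ m) (N : ℕ) :
    f ^ N ∈ I ^ (m * (N / n)) := by
  have h1 : f ^ N = (f ^ n) ^ (N / n) * f ^ (N % n) := by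
    rw [← pow_mul, ← pow_add, Nat.div_add_mod]
  rw [h1, pow_mul]
  exact Ideal.mul_mem_right _ _ (Ideal.pow_mem_pow h _)

theorem eventually_le_idealOrder_div {I : Ideal A} {f : A} {m n : ℕ} (hn : 0 < n)
    (h : f ^ n ∈ I ^ m) {c : ℝ≥0∞} (hc : c < (m : ℝ≥0∞) / n) :
    ∀ᶠ N : ℕ in atTop, c ≤ idealOrder I (f ^ N) / (N : ℝ≥0∞) := by
  have hct : c ≠ ⊤ := hc.ne_top
  lift c to NNReal using hct
  have hn' : (0 : ℝ) < n := by exact_mod_cast hn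
  have hc' : (c : ℝ) < (m : ℝ) / n := by
    have h1 : (m : ℝ≥0∞) / n = (((m : NNReal) / (n : NNReal) : NNReal) : ℝ≥0∞) := by
      rw [ENNReal.coe_div (by exact_mod_cast hn.ne')]
      simp
    rw [h1, ENNReal.coe_lt_coe] at hc
    exact_mod_cast hc
  obtain ⟨K, hK⟩ := exists_nat_gt ((m : ℝ) / ((m : ℝ) / n - c))
  filter_upwards [eventually_ge_atTop (K + 1)] with N hN
  have hN0 : (0 : ℝ) < N := by exact_mod_cast (by omega : 0 < N)
  have hKN : (K : ℝ) ≤ N := by exact_mod_cast (by omega : K ≤ N)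
  rw [ENNReal.le_div_iff_mul_le (Or.inl (by exact_mod_cast (by omega : N ≠ 0)))
    (Or.inl (ENNReal.natCast_ne_top N))]
  refine le_trans ?_ (le_idealOrder (pow_mem_pow_mul_div h N))
  have h2 : (c : ℝ) * N ≤ ((m * (N / n) : ℕ) : ℝ) := by
    have h3 : (N : ℝ) / n - 1 ≤ ((N / n : ℕ) : ℝ) := by
      have h4 : N < n * (N / n + 1) := Nat.lt_mul_div_succ N hn
      have h5 : (N : ℝ) < n * (((N / n : ℕ) : ℝ) + 1) := by exact_mod_cast h4
      have : (N : ℝ) / n < ((N / n : ℕ) : ℝ) + 1 := by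
        rw [div_lt_iff₀ hn']; linarith
      linarith
    have h6 : (m : ℝ) < N * ((m : ℝ) / n - c) := by
      have := (div_lt_iff₀ (sub_pos.mpr hc')).mp hK
      have h7 := mul_le_mul_of_nonneg_right hKN (sub_pos.mpr hc').le
      linarith
    have h8 : (m : ℝ) * ((N : ℝ) / n - 1) ≤ m * ((N / n : ℕ) : ℝ) :=
      mul_le_mul_of_nonneg_left h3 (Nat.cast_nonneg m)
    have h9 : (m : ℝ) * ((N : ℝ) / n) = N * ((m : ℝ) / n) := by ring
    push_cast
    nlinarith
  have h10 : (c : NNReal) * (N : NNReal) ≤ ((m * (N / n) : ℕ) : NNReal) := by exact_mod_cast h2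
  exact_mod_cast h10

theorem div_le_liminf {I : Ideal A} {f : A} {m n : ℕ} (hn : 0 < n) (h : f ^ n ∈ I ^ m) :
    (m : ℝ≥0∞) / n ≤ liminf (fun N : ℕ => idealOrder I (f ^ N) / (N : ℝ≥0∞)) atTop :=
  le_of_forall_lt_imp_le_of_dense fun _ hc =>
    le_liminf_of_le (by isBoundedDefault) (eventually_le_idealOrder_div hn h hc)

theorem exists_of_lt_idealOrder_div {I : Ideal A} {f : A} {n : ℕ} (hn : 0 < n) {c : ℝ≥0∞}
    (hc : c < idealOrder I (f ^ n) / (n : ℝ≥0∞)) :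
    ∃ m : ℕ, f ^ n ∈ I ^ m ∧ c < (m : ℝ≥0∞) / n := by
  have hn0 : (n : ℝ≥0∞) ≠ 0 := by exact_mod_cast hn.ne'
  rw [ENNReal.lt_div_iff_mul_lt (Or.inl hn0) (Or.inl (ENNReal.natCast_ne_top n))] at hc
  unfold idealOrder at hc
  obtain ⟨m, hm⟩ := lt_iSup_iff.mp hc
  obtain ⟨hmem, hlt⟩ := lt_iSup_iff.mp hm
  exact ⟨m, hmem, (ENNReal.lt_div_iff_mul_lt (Or.inl hn0)
    (Or.inl (ENNReal.natCast_ne_top n))).mpr hlt⟩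

theorem div_le_asymptoticSamuel {I : Ideal A} {f : A} {m n : ℕ} (hn : 0 < n)
    (h : f ^ n ∈ I ^ m) : (m : ℝ≥0∞) / n ≤ asymptoticSamuel I f :=
  (div_le_liminf hn h).trans (liminf_le_limsup)

theorem exists_of_lt_asymptoticSamuel {I : Ideal A} {f : A} {c : ℝ≥0∞}
    (hc : c < asymptoticSamuel I f) :
    ∃ n m : ℕ, 0 < n ∧ f ^ n ∈ I ^ m ∧ c < (m : ℝ≥0∞) / n := by
  have h1 : ∃ᶠ n : ℕ in atTop, c < idealOrder I (f ^ n) / (n : ℝ≥0∞) :=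
    frequently_lt_of_lt_limsup (by isBoundedDefault) hc
  obtain ⟨n, hlt, hn⟩ := (h1.and_eventually (eventually_gt_atTop 0)).exists
  obtain ⟨m, hm, hcm⟩ := exists_of_lt_idealOrder_div hn hlt
  exact ⟨n, m, hn, hm, hcm⟩

/-- The limit defining the asymptotic Samuel function exists. -/
theorem tendsto_asymptoticSamuel (I : Ideal A) (f : A) :
    Tendsto (fun n : ℕ => idealOrder I (f ^ n) / (n : ℝ≥0∞)) atTop
      (𝓝 (asymptoticSamuel I f)) := by
  refine tendsto_of_le_liminf_of_limsup_le ?_ le_rfl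
  refine le_of_forall_lt fun c hc => ?_
  obtain ⟨n, m, hn, hm, hcm⟩ := exists_of_lt_asymptoticSamuel hc
  exact hcm.trans_le (div_le_liminf hn hm)

theorem asymptoticSamuel_zero (I : Ideal A) : asymptoticSamuel I 0 = ⊤ := by
  refine ENNReal.eq_top_of_forall_nnreal_le fun r => ?_
  obtain ⟨m, hm⟩ := exists_nat_ge r
  have h := div_le_asymptoticSamuel (I := I) (f := 0) (m := m) (n := 1) one_pos (by simp)
  refine le_trans ?_ h
  simp only [Nat.cast_one, div_one]
  exact_mod_cast hm

theorem asymptoticSamuel_mul_left (I : Ideal A) (c f : A) :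
    asymptoticSamuel I f ≤ asymptoticSamuel I (c * f) := by
  refine le_of_forall_lt fun r hr => ?_
  obtain ⟨n, m, hn, hm, hrm⟩ := exists_of_lt_asymptoticSamuel hr
  refine hrm.trans_le (div_le_asymptoticSamuel hn ?_)
  rw [mul_pow]
  exact Ideal.mul_mem_left _ _ hm

theorem asymptoticSamuel_add (I : Ideal A) (a b : A) :
    min (asymptoticSamuel I a) (asymptoticSamuel I b) ≤ asymptoticSamuel I (a + b) := by
  refine le_of_forall_lt fun r hr => ?_
  obtain ⟨n, p, hn, hp, hrp⟩ := exists_of_lt_asymptoticSamuel (hr.trans_le (min_le_left _ _))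
  obtain ⟨n', q, hn', hq, hrq⟩ := exists_of_lt_asymptoticSamuel (hr.trans_le (min_le_right _ _))
  -- a common exponent
  obtain ⟨N, M, hN, ha, hb, hrM⟩ : ∃ N M : ℕ, 0 < N ∧ a ^ N ∈ I ^ M ∧ b ^ N ∈ I ^ M ∧
      r < (M : ℝ≥0∞) / N := by
    refine ⟨n * n', min (p * n') (q * n), Nat.mul_pos hn hn', ?_, ?_, ?_⟩
    · rw [pow_mul]
      have := Ideal.pow_mem_pow hp n'
      rw [← pow_mul] at this
      exact Ideal.pow_le_pow_right (min_le_left _ _) this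
    · rw [mul_comm n n', pow_mul]
      have := Ideal.pow_mem_pow hq n
      rw [← pow_mul] at this
      exact Ideal.pow_le_pow_right (min_le_right _ _) this
    · have e1 : ((p * n' : ℕ) : ℝ≥0∞) / ((n * n' : ℕ) : ℝ≥0∞) = (p : ℝ≥0∞) / n := by
        push_cast
        exact ENNReal.mul_div_mul_right _ _ (by exact_mod_cast hn'.ne')
          (ENNReal.natCast_ne_top _)
      have e2 : ((q * n : ℕ) : ℝ≥0∞) / ((n * n' : ℕ) : ℝ≥0∞) = (q : ℝ≥0∞) / n' := by
        push_cast
        rw [mul_comm (n : ℝ≥0∞)]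
        exact ENNReal.mul_div_mul_right _ _ (by exact_mod_cast hn.ne')
          (ENNReal.natCast_ne_top _)
      rcases min_choice (p * n') (q * n) with h | h <;> rw [h]
      · rwa [e1]
      · rwa [e2]
  have hpow : ∀ k : ℕ, (a + b) ^ (N * (k + 1)) ∈ I ^ (M * k) := by
    intro k
    rw [add_pow]
    refine Ideal.sum_mem _ fun i hi => Ideal.mul_mem_right _ _ ?_
    have hi' : i ≤ N * (k + 1) := Nat.lt_succ_iff.mp (Finset.mem_range.mp hi)
    have h1 := Ideal.mul_mem_mul (pow_mem_pow_mul_div ha i)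
      (pow_mem_pow_mul_div hb (N * (k + 1) - i))
    rw [← pow_add, ← mul_add] at h1
    refine Ideal.pow_le_pow_right (Nat.mul_le_mul_left M ?_) h1
    have h2 := Nat.lt_mul_div_succ i hN
    have h3 := Nat.lt_mul_div_succ (N * (k + 1) - i) hN
    have h4 : N * (k + 1) < N * (i / N + (N * (k + 1) - i) / N + 2) := by
      have : N * (i / N + (N * (k + 1) - i) / N + 2) =
        N * (i / N + 1) + N * ((N * (k + 1) - i) / N + 1) := by ring
      omega
    have h5 := Nat.lt_of_mul_lt_mul_left h4
    omega
  refine hrM.trans_le ?_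
  by_cases htop : asymptoticSamuel I (a + b) = ⊤
  · rw [htop]; exact le_top
  have hN' : (N : ℝ≥0∞) ≠ 0 := by exact_mod_cast hN.ne'
  have hle : ∀ k : ℕ, ((M * k : ℕ) : ℝ≥0∞) ≤
      asymptoticSamuel I (a + b) * ((N * (k + 1) : ℕ) : ℝ≥0∞) := fun k =>
    (ENNReal.div_le_iff_le_mul (Or.inl (by exact_mod_cast (Nat.mul_pos hN k.succ_pos).ne'))
      (Or.inl (ENNReal.natCast_ne_top _))).mp
      (div_le_asymptoticSamuel (Nat.mul_pos hN k.succ_pos) (hpow k))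
  rw [ENNReal.div_le_iff_le_mul (Or.inl hN') (Or.inl (ENNReal.natCast_ne_top _))]
  generalize asymptoticSamuel I (a + b) = x at *
  lift x to NNReal using htop
  have hle' : ∀ k : ℕ, (M : ℝ) * k ≤ (x : ℝ) * (N * (k + 1)) := fun k => by
    have h1 : ((M * k : ℕ) : NNReal) ≤ x * ((N * (k + 1) : ℕ) : NNReal) := by
      have := hle k
      exact_mod_cast this
    exact_mod_cast h1
  have hfin : (M : ℝ) ≤ x * N := by
    by_contra hcon
    obtain ⟨k, hk⟩ := exists_nat_gt ((x : ℝ) * N / (M - x * N))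
    have h1 := (div_lt_iff₀ (by linarith [not_le.mp hcon])).mp hk
    have h2 := hle' k
    nlinarith
  have h11 : ((M : ℕ) : NNReal) ≤ x * (N : NNReal) := by exact_mod_cast hfin
  exact_mod_cast h11

/-- The ideal `I^{≥ r} = {f ∣ ν̄_I(f) ≥ r}`. -/
noncomputable def samuelGe (I : Ideal A) (r : ℝ≥0∞) : Ideal A where
  carrier := {f | r ≤ asymptoticSamuel I f}
  zero_mem' := by simp [asymptoticSamuel_zero]
  add_mem' ha hb := (le_min ha hb).trans (asymptoticSamuel_add I _ _)
  smul_mem' c _ h := le_trans h (asymptoticSamuel_mul_left I c _)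

/-- The ideal `I^{> r} = {f ∣ ν̄_I(f) > r}`, for finite `r`. -/
noncomputable def samuelGt (I : Ideal A) (r : NNReal) : Ideal A where
  carrier := {f | (r : ℝ≥0∞) < asymptoticSamuel I f}
  zero_mem' := by simp [asymptoticSamuel_zero]
  add_mem' ha hb := (lt_min ha hb).trans_le (asymptoticSamuel_add I _ _)
  smul_mem' c _ h := lt_of_lt_of_le h (asymptoticSamuel_mul_left I c _)

theorem le_samuelGe_one (I : Ideal A) : I ≤ samuelGe I 1 := fun f hf => by
  have h := div_le_asymptoticSamuel (I := I) (f := f) (m := 1) (n := 1) one_pos (by simpa using hf)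
  change 1 ≤ asymptoticSamuel I f
  simpa using h

theorem mul_mem_samuelGt_one {I : Ideal A} {x y : A} (hx : x ∈ I) (hy : y ∈ I) :
    x * y ∈ samuelGt I 1 := by
  have h := div_le_asymptoticSamuel (I := I) (f := x * y) (m := 2) (n := 1) one_pos
    (by rw [pow_one, pow_two]; exact Ideal.mul_mem_mul hx hy)
  change ((1 : NNReal) : ℝ≥0∞) < asymptoticSamuel I (x * y)
  refine lt_of_lt_of_le ?_ h
  simp

/-- The piece `I^{≥ 1} / I^{> 1}` of degree one of the graded ring of `ν̄_I`. -/
abbrev SamuelGradedOne (I : Ideal A) : Type _ :=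
  samuelGe I 1 ⧸ Submodule.comap (Submodule.subtype (samuelGe I 1)) (samuelGt I 1)

/-- The class of an element of `I` in `I^{≥ 1} / I^{> 1}`. -/
noncomputable def samuelClass (I : Ideal A) : I →ₗ[A] SamuelGradedOne I :=
  LinearMap.comp
    (Submodule.mkQ (Submodule.comap (Submodule.subtype (samuelGe I 1)) (samuelGt I 1)))
    (Submodule.inclusion (le_samuelGe_one I))

theorem samuelClass_eq_zero_iff (I : Ideal A) (x : I) :
    samuelClass I x = 0 ↔ (x : A) ∈ samuelGt I 1 := by
  unfold samuelClass
  rw [LinearMap.comp_apply, Submodule.mkQ_apply, Submodule.Quotient.mk_eq_zero,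
    Submodule.mem_comap]
  rfl

theorem samuelClass_mul (I : Ideal A) (x y : I) : samuelClass I (x * y) = 0 :=
  (samuelClass_eq_zero_iff I (x * y)).mpr (mul_mem_samuelGt_one x.2 y.2)

/-- The natural map `λ_I : I / I² → I^{≥ 1} / I^{> 1}`. -/
noncomputable def samuelMap (I : Ideal A) : I.Cotangent →ₗ[A] SamuelGradedOne I :=
  Ideal.Cotangent.lift (samuelClass I) (samuelClass_mul I)

end Samuel

/-! ### The Samuel slope -/

section Slope

variable (B : Type*) [CommRing B] [IsLocalRing B]

/-- The kernel of `λ_𝔪 : 𝔪 / 𝔪² → 𝔪^{≥ 1} / 𝔪^{> 1}`, as a subspace of `𝔪 / 𝔪²` over the residue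
field. -/
noncomputable def samuelKer : Submodule (ResidueField B) (CotangentSpace B) where
  carrier := {x | samuelMap (maximalIdeal B) x = 0}
  zero_mem' := map_zero _
  add_mem' {x y} hx hy := by
    change samuelMap (maximalIdeal B) (x + y) = 0
    rw [map_add, show samuelMap (maximalIdeal B) x = 0 from hx,
      show samuelMap (maximalIdeal B) y = 0 from hy, add_zero]
  smul_mem' c x hx := by
    obtain ⟨b, rfl⟩ := residue_surjective (R := B) c
    have h : residue B b • x = b • x := algebraMap_smul (ResidueField B) b x
    change samuelMap (maximalIdeal B) (residue B b • x) = 0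
    rw [h, map_smul, show samuelMap (maximalIdeal B) x = 0 from hx, smul_zero]

/-- The excess of embedding dimension `dim_k (𝔪 / 𝔪²) - dim B`. For a Noetherian local ring the
dimension is finite and at most the embedding dimension, so neither `toNat` nor the subtraction
loses anything. -/
noncomputable def excEmbDim : ℕ :=
  Module.finrank (ResidueField B) (CotangentSpace B) - ((ringKrullDim B).unbotD 0).toNat

/-- A `λ_𝔪`-sequence: elements of `𝔪` indexed by `1, …, t`, with `t` the excess of embedding
dimension, whose classes in `𝔪 / 𝔪²` form a basis of `ker λ_𝔪`. -/
def IsLambdaSequence (γ : Fin (excEmbDim B) → maximalIdeal B) : Prop :=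
  LinearIndependent (ResidueField B)
      (fun i => ((maximalIdeal B).toCotangent (γ i) : CotangentSpace B)) ∧
    Submodule.span (ResidueField B)
      (Set.range fun i => ((maximalIdeal B).toCotangent (γ i) : CotangentSpace B)) = samuelKer B

open Classical in
/-- The Samuel slope of a Noetherian local ring `B`, in `[0, ∞]`: it is `∞` if `B` is regular; if
`B` is in the extremal case, i.e. it is not regular and `ker λ_𝔪` has dimension equal to the excess
of embedding dimension, it is the supremum over all `λ_𝔪`-sequences `γ₁, …, γ_t` of
`min {ν̄_𝔪(γ₁), …, ν̄_𝔪(γ_t)}`; otherwise it is `1`. -/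
noncomputable def samuelSlope : ℝ≥0∞ :=
  if IsRegularLocalRing B then ⊤
  else if Module.finrank (ResidueField B) (samuelKer B) = excEmbDim B then
    ⨆ (γ : Fin (excEmbDim B) → maximalIdeal B) (_ : IsLambdaSequence B γ),
      ⨅ i, asymptoticSamuel (maximalIdeal B) (γ i : B)
  else 1

end Slope

/-- The reduction `B_red = B / Nil(B)` of a local ring is local. -/
instance isLocalRing_quotient_nilradical (B : Type*) [CommRing B] [IsLocalRing B] :
    IsLocalRing (B ⧸ nilradical B) :=
  haveI : Nontrivial (B ⧸ nilradical B) := Ideal.Quotient.nontrivial_iff.mpr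
    (fun h => one_ne_zero (α := B) (by
      have h1 : (1 : B) ∈ nilradical B := h ▸ Submodule.mem_top
      obtain ⟨n, hn⟩ := mem_nilradical.mp h1
      simp at hn))
  IsLocalRing.of_surjective' (Ideal.Quotient.mk (nilradical B)) Ideal.Quotient.mk_surjective

/-! ### Equicharacteristic, equidimensional and excellent rings -/

/-- A local ring is equicharacteristic if it has the same characteristic as its residue field. -/
def IsEquicharacteristic (B : Type*) [CommRing B] [IsLocalRing B] : Prop :=
  ringChar B = ringChar (ResidueField B)

/-- A ring is equidimensional if `dim B / 𝔭 = dim B` for every minimal prime `𝔭`. -/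
def IsEquidimensional (B : Type*) [CommRing B] : Prop :=
  ∀ p ∈ minimalPrimes B, ringKrullDim (B ⧸ p) = ringKrullDim B

/-- A ring is catenary if for all primes `p ≤ q` the chains of primes from `p` to `q` have bounded
length and all the maximal (i.e. saturated) ones have the same length. -/
def IsCatenaryRing (R : Type*) [CommRing R] : Prop :=
  ∀ p q : PrimeSpectrum R, p ≤ q → ∃ n : ℕ,
    (∀ s : LTSeries (PrimeSpectrum R), s.head = p → s.last = q → s.length ≤ n) ∧
    ∀ s : RelSeries {(a, b) : PrimeSpectrum R × PrimeSpectrum R | a ⋖ b},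
      s.head = p → s.last = q → s.length = n

/-- A ring is universally catenary if it is Noetherian and all its algebras of finite type are
catenary. -/
def IsUniversallyCatenary (R : Type u) [CommRing R] : Prop :=
  IsNoetherianRing R ∧
    ∀ (S : Type u) [CommRing S] [Algebra R S] [Algebra.FiniteType R S], IsCatenaryRing S

/-- An algebra `C` over a field `k` is geometrically regular if `K ⊗ C` is a regular ring for every
finite field extension `K` of `k`. -/
def IsGeometricallyRegular (k : Type u) [Field k] (C : Type u) [CommRing C] [Algebra k C] : Prop :=
  ∀ (K : Type u) [Field K] [Algebra k K] [FiniteDimensional k K], IsRegularRing (K ⊗[k] C)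

/-- A Noetherian ring is a G-ring if for every prime `q` the fibres of the completion map
`R_q → (R_q)^` are geometrically regular. -/
def IsGRing (R : Type u) [CommRing R] : Prop :=
  IsNoetherianRing R ∧
    ∀ (q : Ideal R) [q.IsPrime] (p : Ideal (Localization.AtPrime q)) [p.IsPrime],
      IsGeometricallyRegular p.ResidueField
        (p.Fiber (AdicCompletion (maximalIdeal (Localization.AtPrime q)) (Localization.AtPrime q)))

/-- A Noetherian ring is J-2 if every algebra of finite type over it has an open regular locus. -/
def IsJ2Ring (R : Type u) [CommRing R] : Prop :=
  IsNoetherianRing R ∧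
    ∀ (S : Type u) [CommRing S] [Algebra R S] [Algebra.FiniteType R S],
      IsOpen {p : PrimeSpectrum S | IsRegularLocalRing (Localization.AtPrime p.asIdeal)}

/-- A ring is excellent if it is Noetherian, universally catenary, a G-ring and J-2. -/
structure IsExcellentRing (R : Type u) [CommRing R] : Prop where
  isNoetherianRing : IsNoetherianRing R
  universallyCatenary : IsUniversallyCatenary R
  gRing : IsGRing R
  j2 : IsJ2Ring R

/-! ### Functoriality of the asymptotic Samuel function and its blindness to nilpotents -/

section SamuelFunction

variable {A C : Type*} [CommRing A] [CommRing C]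

/-! The function ν̄ does not see nilpotents: ν̄ takes the same value at f and at its class in B_red
(`asymptoticSamuel_mk_nilradical`). Hence (𝔪/𝔪²)/ker λ has the same dimension for both rings, and so
does the ring itself, so B and B_red are extremal simultaneously. In the extremal case the slope is
the supremum of the r ∈ [0, ∞] with 𝔪^{>1} ⊆ 𝔪^{≥r} + 𝔪² (`iSup_isLambdaSequence_eq_sSup`), a
condition that passes between B and B_red.

B itself is not regular, since regular local rings are domains. If B_red is regular, then 𝔪^{>1} ⊆
𝔪² there, so r = ∞ is admissible and the slope of B is infinite.

If B_red is not regular, finiteness is a Chevalley-type theorem: some n satisfies 𝔪^{≥n} ⊆ 𝔪² +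
Nil(B) (`exists_samuelGe_le_of_isGRing`). Otherwise a Cauchy sequence produces an element of the
completion with ν̄ = ∞. Such an element is nilpotent, hence comes from Nil(B) because the formal
fibres of a G-ring are reduced, which is a contradiction modulo 𝔪². A slope of B_red above n would
then force 𝔪^{>1} ⊆ 𝔪², so ker λ = 0, t = 0, and B_red would be regular. -/

theorem mem_samuelGe {I : Ideal A} {r : ℝ≥0∞} {f : A} :
    f ∈ samuelGe I r ↔ r ≤ asymptoticSamuel I f := Iff.rfl

theorem mem_samuelGt {I : Ideal A} {r : NNReal} {f : A} :
    f ∈ samuelGt I r ↔ (r : ℝ≥0∞) < asymptoticSamuel I f := Iff.rfl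

theorem samuelGe_anti (I : Ideal A) : Antitone (samuelGe I) := fun _ _ h _ hf => h.trans hf

theorem asymptoticSamuel_le_map (φ : A →+* C) {I : Ideal A} {J : Ideal C} (h : I.map φ ≤ J)
    (f : A) : asymptoticSamuel I f ≤ asymptoticSamuel J (φ f) := by
  refine le_of_forall_lt fun r hr => ?_
  obtain ⟨n, m, hn, hm, hrm⟩ := exists_of_lt_asymptoticSamuel hr
  refine hrm.trans_le (div_le_asymptoticSamuel hn ?_)
  rw [← map_pow]
  refine Ideal.pow_right_mono h m ?_
  rw [← Ideal.map_pow]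
  exact Ideal.mem_map_of_mem φ hm

theorem le_asymptoticSamuel_of_mem {I : Ideal A} {f : A} {m : ℕ} (h : f ∈ I ^ m) :
    (m : ℝ≥0∞) ≤ asymptoticSamuel I f := by
  simpa using div_le_asymptoticSamuel (I := I) (f := f) one_pos (by simpa using h)

theorem asymptoticSamuel_pow_le (I : Ideal A) (f : A) {n : ℕ} (hn : 0 < n) :
    asymptoticSamuel I (f ^ n) / n ≤ asymptoticSamuel I f := by
  have hn0 : (n : ℝ≥0∞) ≠ 0 := by exact_mod_cast hn.ne'
  have hnt := ENNReal.natCast_ne_top n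
  rw [ENNReal.div_le_iff_le_mul (Or.inl hn0) (Or.inl hnt)]
  refine le_of_forall_lt fun r hr => ?_
  obtain ⟨a, b, ha, hb, hrb⟩ := exists_of_lt_asymptoticSamuel hr
  rw [← pow_mul] at hb
  have h := div_le_asymptoticSamuel (Nat.mul_pos hn ha) hb
  refine hrb.trans_le ?_
  rw [← ENNReal.div_le_iff_le_mul (Or.inl hn0) (Or.inl hnt)]
  refine le_trans (le_of_eq ?_) h
  push_cast
  rw [ENNReal.div_eq_inv_mul, ENNReal.div_eq_inv_mul, ENNReal.div_eq_inv_mul,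
    ENNReal.mul_inv (Or.inl hn0) (Or.inl hnt), mul_assoc]

theorem asymptoticSamuel_of_isNilpotent (I : Ideal A) {f : A} (hf : IsNilpotent f) :
    asymptoticSamuel I f = ⊤ := by
  obtain ⟨n, hn⟩ := hf
  have h := asymptoticSamuel_pow_le I f n.succ_pos
  rw [pow_succ, hn, zero_mul, asymptoticSamuel_zero,
    ENNReal.top_div_of_ne_top (ENNReal.natCast_ne_top _)] at h
  exact top_le_iff.mp h

theorem mem_of_asymptoticSamuel_pos {I : Ideal A} [I.IsPrime] {f : A}
    (h : 0 < asymptoticSamuel I f) : f ∈ I := by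
  obtain ⟨n, m, _, hm, hlt⟩ := exists_of_lt_asymptoticSamuel h
  have hm0 : m ≠ 0 := by
    rintro rfl
    simp at hlt
  exact ‹I.IsPrime›.mem_of_pow_mem n (Ideal.pow_le_self hm0 hm)

/-- If φ(f)^n lies in the m-th power of the image ideal, then f^n = a + (nilpotent) with a ∈ I^m.
The nilpotent part has ν̄ = ∞, so ν̄(f^n) ≥ m, and dividing by n gives the bound for f. -/
theorem asymptoticSamuel_of_surjective (φ : A →+* C) (hφ : Function.Surjective φ)
    (hker : RingHom.ker φ ≤ nilradical A) (I : Ideal A) (f : A) :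
    asymptoticSamuel (I.map φ) (φ f) = asymptoticSamuel I f := by
  refine le_antisymm (le_of_forall_lt fun r hr => ?_) (asymptoticSamuel_le_map φ le_rfl f)
  obtain ⟨n, m, hn, hm, hrm⟩ := exists_of_lt_asymptoticSamuel hr
  refine hrm.trans_le ?_
  rw [← map_pow, ← Ideal.map_pow, Ideal.mem_map_iff_of_surjective φ hφ] at hm
  obtain ⟨a, ha, hfa⟩ := hm
  have hnil : IsNilpotent (f ^ n - a) :=
    mem_nilradical.mp (hker (by rw [RingHom.mem_ker, map_sub, hfa, sub_self]))
  have h1 := asymptoticSamuel_add I a (f ^ n - a)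
  rw [asymptoticSamuel_of_isNilpotent I hnil, min_top_right, add_sub_cancel] at h1
  exact (ENNReal.div_le_div_right ((le_asymptoticSamuel_of_mem ha).trans h1) _).trans
    (asymptoticSamuel_pow_le I f hn)

end SamuelFunction

/-! ### A unit argument for redundant generators -/

section LocalRings

variable {A : Type*} [CommRing A] [IsLocalRing A]

/-- If `f ^ n` lies in the `(n + 1)`-st power of `(f) + X`, then `f` lies in the radical of `X`. -/
theorem pow_mem_of_pow_mem_sup_pow {X : Ideal A} {f : A} (hf : f ∈ maximalIdeal A) {n : ℕ}
    (h : f ^ n ∈ (Ideal.span {f} ⊔ X) ^ (n + 1)) : f ^ n ∈ X := by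
  have h1 := Ideal.mem_map_of_mem (Ideal.Quotient.mk X) h
  rw [Ideal.map_pow, Ideal.map_sup, Ideal.map_quotient_self, sup_bot_eq, Ideal.map_span,
    Set.image_singleton, Ideal.span_singleton_pow, Ideal.mem_span_singleton', map_pow] at h1
  obtain ⟨a, ha⟩ := h1
  obtain ⟨b, rfl⟩ := Ideal.Quotient.mk_surjective a
  -- Modulo X the hypothesis reads f^n = b f^(n+1), that is f^n (1 - bf) = 0.
  have hu : IsUnit (1 - b * f) := by
    by_contra hu
    have h2 := (maximalIdeal A).add_mem ((mem_maximalIdeal _).mpr hu)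
      ((maximalIdeal A).mul_mem_left b hf)
    rw [sub_add_cancel] at h2
    exact (mem_maximalIdeal _).mp h2 isUnit_one
  rw [← map_pow, ← map_pow, ← map_mul, Ideal.Quotient.eq] at ha
  have h3 : f ^ n * (1 - b * f) ∈ X := by
    rw [show f ^ n * (1 - b * f) = -(b * f ^ (n + 1) - f ^ n) by ring]
    exact X.neg_mem ha
  exact (X.mul_unit_mem_iff_mem hu).mp h3

end LocalRings

/-! ### Systems of parameters bound ν̄ -/

section Parameters

variable {A : Type*} [CommRing A] [IsLocalRing A] [IsNoetherianRing A]

/-- An element of `𝔪` outside `𝔪²` is part of a minimal system of generators of `𝔪`. -/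
theorem exists_finset_span_sup_eq_maximalIdeal {f : A} (hf : f ∈ maximalIdeal A)
    (hf2 : f ∉ maximalIdeal A ^ 2) :
    ∃ s : Finset A, Ideal.span {f} ⊔ Ideal.span (s : Set A) = maximalIdeal A ∧
      s.card + 1 ≤ (maximalIdeal A).spanFinrank := by
  classical
  set v : CotangentSpace A := (maximalIdeal A).toCotangent ⟨f, hf⟩ with hv
  have hv0 : v ≠ 0 := fun h => hf2 (by
    rwa [hv, Ideal.toCotangent_eq_zero] at h)
  have hli : LinearIndepOn (ResidueField A) id ({v} : Set (CotangentSpace A)) :=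
    LinearIndepOn.singleton hv0
  set T := hli.extend (Set.subset_univ _) with hT
  let b := Module.Basis.extend hli
  have hvT : v ∈ T := hli.subset_extend _ rfl
  have : Fintype T := Module.Basis.fintypeIndexOfRankLtAleph0 b (Module.rank_lt_aleph0 _ _)
  let l : CotangentSpace A → maximalIdeal A := Function.surjInv (Ideal.toCotangent_surjective _)
  have hl : ∀ x, (maximalIdeal A).toCotangent (l x) = x :=
    Function.surjInv_eq (Ideal.toCotangent_surjective _)
  let T' : Finset (CotangentSpace A) := T.toFinset.erase v
  let s₀ : Set (maximalIdeal A) := insert ⟨f, hf⟩ (l '' (T' : Set _))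
  have hspan : Submodule.span A s₀ = ⊤ := by
    rw [← CotangentSpace.span_image_eq_top_iff, eq_top_iff]
    have hb : Submodule.span (ResidueField A) T = ⊤ := by
      have := b.span_eq
      rwa [show Set.range b = T by
        simp [b, hT, Module.Basis.coe_extend]] at this
    rw [← hb]
    refine Submodule.span_mono fun x hx => ?_
    by_cases hxv : x = v
    · exact ⟨⟨f, hf⟩, Set.mem_insert _ _, by rw [hxv]⟩
    · exact ⟨l x, Set.mem_insert_of_mem _ ⟨x, by simp [T', hxv, hx], rfl⟩, hl x⟩
  refine ⟨T'.image fun x => (l x : A), ?_, ?_⟩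
  · have h1 := congrArg (Submodule.map (Submodule.subtype (maximalIdeal A))) hspan
    rw [Submodule.map_span, Submodule.map_subtype_top] at h1
    rw [← Ideal.span_union]
    refine Eq.trans ?_ h1
    change Submodule.span A _ = _
    congr 1
    simp only [s₀, Set.image_insert_eq, Set.image_image, Finset.coe_image, Set.singleton_union]
    rfl
  · rw [spanFinrank_maximalIdeal_eq_finrank_cotangentSpace, Module.finrank_eq_card_basis b]
    have h1 : (T'.image fun x => (l x : A)).card ≤ T'.card := Finset.card_image_le
    have h2 : T'.card + 1 = T.toFinset.card :=
      Finset.card_erase_add_one (by simpa using hvT)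
    exact (Nat.add_le_add_right h1 1).trans (h2.trans (Set.toFinset_card T)).le

theorem ringKrullDim_le_card_of_maximalIdeal_le_radical {s : Finset A}
    (hs : Ideal.span (s : Set A) ≤ maximalIdeal A)
    (h : maximalIdeal A ≤ (Ideal.span (s : Set A)).radical) : ringKrullDim A ≤ s.card := by
  rw [← maximalIdeal_height_eq_ringKrullDim]
  have hmin : maximalIdeal A ∈ (Ideal.span (s : Set A)).minimalPrimes :=
    ⟨⟨inferInstance, hs⟩, fun q hq _ => h.trans (hq.1.radical_le_iff.mpr hq.2)⟩
  exact_mod_cast Ideal.height_le_card_of_mem_minimalPrimes_span_finset hmin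

/-- The relation puts f in the radical of (s), so s alone generates an 𝔪-primary ideal and Krull's
height theorem applies. Both bounds on ν̄ below contradict this when s has fewer than dim A
elements. -/
theorem ringKrullDim_le_card_of_pow_mem {s : Finset A} {f : A}
    (hle : Ideal.span {f} ⊔ Ideal.span (s : Set A) ≤ maximalIdeal A)
    (hrad : maximalIdeal A ≤ (Ideal.span {f} ⊔ Ideal.span (s : Set A)).radical) {n : ℕ}
    (h : f ^ n ∈ (Ideal.span {f} ⊔ Ideal.span (s : Set A)) ^ (n + 1)) :
    ringKrullDim A ≤ s.card := by
  have hf : f ∈ maximalIdeal A :=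
    hle (Ideal.mem_sup_left (Ideal.mem_span_singleton_self f))
  refine ringKrullDim_le_card_of_maximalIdeal_le_radical (le_sup_right.trans hle)
    (hrad.trans ?_)
  rw [← Ideal.radical_idem (Ideal.span (s : Set A))]
  refine Ideal.radical_mono (sup_le ?_ Ideal.le_radical)
  rw [Ideal.span_singleton_le_iff_mem]
  exact ⟨n, pow_mem_of_pow_mem_sup_pow hf h⟩

/-- Parameters of A/(f) lift to a set s of at most dim A - 1 elements with q = (f, s) ⊇ 𝔪^k for some
k. A large ν̄(f) would give f^n ∈ q^(n+1), making f redundant and forcing dim A ≤ |s|. -/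
theorem asymptoticSamuel_ne_top [IsDomain A] {f : A} (hf : f ≠ 0) :
    asymptoticSamuel (maximalIdeal A) f ≠ ⊤ := by
  classical
  intro htop
  have hfm : f ∈ maximalIdeal A := mem_of_asymptoticSamuel_pos (by rw [htop]; simp)
  have hne : Ideal.span {f} ≠ ⊤ := fun h => by
    have : Ideal.span {f} ≤ maximalIdeal A := by rwa [Ideal.span_singleton_le_iff_mem]
    rw [h, top_le_iff] at this
    exact Ideal.IsPrime.ne_top' this
  have : Nontrivial (A ⧸ Ideal.span {f}) := Ideal.Quotient.nontrivial_iff.mpr hne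
  let π := Ideal.Quotient.mk (Ideal.span {f})
  have hπ : Function.Surjective π := Ideal.Quotient.mk_surjective
  have : IsLocalRing (A ⧸ Ideal.span {f}) := IsLocalRing.of_surjective' π hπ
  have hdim := ringKrullDim_quotient_succ_le_of_nonZeroDivisor (mem_nonZeroDivisors_of_ne_zero hf)
  obtain ⟨t, ht, hcard⟩ := Ideal.exists_finset_card_eq_height_of_isNoetherianRing
    (maximalIdeal (A ⧸ Ideal.span {f}))
  have hsurj : Set.SurjOn π (maximalIdeal A) (t : Set (A ⧸ Ideal.span {f})) := fun x hx => by
    have hxm : x ∈ maximalIdeal (A ⧸ Ideal.span {f}) := ht.1.2 (Ideal.subset_span hx)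
    rw [← map_maximalIdeal_of_surjective π hπ, Ideal.mem_map_iff_of_surjective π hπ] at hxm
    exact hxm
  obtain ⟨s, hsm, hinj, himg⟩ := Finset.exists_subset_injOn_image_eq_of_surjOn _ _ hsurj
  have hscard : s.card = t.card := by rw [← himg, Finset.card_image_of_injOn hinj]
  set q := Ideal.span {f} ⊔ Ideal.span (s : Set A) with hq
  have hqm : q ≤ maximalIdeal A :=
    sup_le ((Ideal.span_singleton_le_iff_mem _).mpr hfm) (Ideal.span_le.mpr hsm)
  have hmap : q.map π = Ideal.span (t : Set (A ⧸ Ideal.span {f})) := by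
    rw [hq, Ideal.map_sup, Ideal.map_quotient_self, bot_sup_eq, Ideal.map_span, ← himg,
      Finset.coe_image]
  have hrad : maximalIdeal A ≤ q.radical := by
    rw [Ideal.radical_eq_sInf]
    refine le_sInf fun p hp => ?_
    obtain ⟨hqp, hp⟩ := hp
    have hker : RingHom.ker π ≤ p := by
      rw [Ideal.mk_ker]; exact le_sup_left.trans hqp
    have hprime : (p.map π).IsPrime := Ideal.map_isPrime_of_surjective hπ hker
    have h1 : maximalIdeal (A ⧸ Ideal.span {f}) ≤ p.map π :=
      ht.2 ⟨hprime, hmap ▸ Ideal.map_mono hqp⟩ (le_maximalIdeal hprime.ne_top)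
    have h2 := Ideal.comap_mono (f := π) h1
    rw [Ideal.comap_map_of_surjective π hπ, ← RingHom.ker_eq_comap_bot, sup_eq_left.mpr hker] at h2
    refine le_trans ?_ h2
    rw [← Ideal.map_le_iff_le_comap, map_maximalIdeal_of_surjective π hπ]
  obtain ⟨k, hk⟩ := Ideal.exists_pow_le_of_le_radical_of_fg hrad (IsNoetherian.noetherian _)
  -- The bound 2k suffices because k(n + 1) ≤ 2kn for n ≥ 1, so f^n ∈ 𝔪^(k(n+1)) ⊆ q^(n+1).
  obtain ⟨n, m, hn, hm, hlt⟩ := exists_of_lt_asymptoticSamuel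
    (htop ▸ ENNReal.natCast_lt_top (2 * k) : ((2 * k : ℕ) : ℝ≥0∞) < _)
  have hnm : 2 * k * n < m := by
    rw [ENNReal.lt_div_iff_mul_lt (Or.inl (by exact_mod_cast hn.ne'))
      (Or.inl (ENNReal.natCast_ne_top n))] at hlt
    exact_mod_cast hlt
  have hmem : f ^ n ∈ q ^ (n + 1) := by
    refine Ideal.pow_right_mono hk (n + 1) ?_
    rw [← pow_mul]
    refine Ideal.pow_le_pow_right ?_ hm
    nlinarith
  have hle := ringKrullDim_le_card_of_pow_mem hqm hrad hmem
  rw [← maximalIdeal_height_eq_ringKrullDim, ← hcard] at hdim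
  have h3 := hdim.trans hle
  rw [hscard] at h3
  have h4 : t.card + 1 ≤ t.card := by exact_mod_cast h3
  omega

theorem isNilpotent_of_asymptoticSamuel_eq_top {f : A}
    (hf : asymptoticSamuel (maximalIdeal A) f = ⊤) : IsNilpotent f := by
  rw [← mem_nilradical, nilradical_eq_sInf]
  refine (Ideal.mem_sInf).mpr fun {p} hp => ?_
  have hp' : p.IsPrime := hp
  let π := Ideal.Quotient.mk p
  have hπ : Function.Surjective π := Ideal.Quotient.mk_surjective
  have : IsLocalRing (A ⧸ p) := IsLocalRing.of_surjective' π hπ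
  by_contra hfp
  refine asymptoticSamuel_ne_top (f := π f)
    (fun h => hfp (Ideal.Quotient.eq_zero_iff_mem.mp h)) ?_
  rw [← top_le_iff, ← hf]
  exact asymptoticSamuel_le_map π (map_maximalIdeal_of_surjective π hπ).le f

/-- An element outside 𝔪² belongs to a minimal generating set of dim A elements. If its ν̄ exceeded
1, some f^n would lie in 𝔪^(n+1), and the remaining dim A - 1 generators would be 𝔪-primary. -/
theorem samuelGt_one_le_sq_of_isRegularLocalRing {A : Type*} [CommRing A] [IsRegularLocalRing A] :
    samuelGt (maximalIdeal A) 1 ≤ maximalIdeal A ^ 2 := by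
  intro f hf
  rw [mem_samuelGt] at hf
  have hfm : f ∈ maximalIdeal A := mem_of_asymptoticSamuel_pos (bot_le.trans_lt hf)
  by_contra hf2
  obtain ⟨s, hs, hcard⟩ := exists_finset_span_sup_eq_maximalIdeal hfm hf2
  obtain ⟨n, m, hn, hm, hlt⟩ := exists_of_lt_asymptoticSamuel hf
  have hnm : n < m := by
    rw [ENNReal.lt_div_iff_mul_lt (Or.inl (by exact_mod_cast hn.ne'))
      (Or.inl (ENNReal.natCast_ne_top n)), ENNReal.coe_one, one_mul] at hlt
    exact_mod_cast hlt
  have h := ringKrullDim_le_card_of_pow_mem hs.le (hs ▸ Ideal.le_radical)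
    (hs ▸ Ideal.pow_le_pow_right (I := maximalIdeal A) hnm hm)
  rw [← (isRegularLocalRing_iff A).mp inferInstance] at h
  have : (maximalIdeal A).spanFinrank ≤ s.card := by exact_mod_cast h
  omega

end Parameters

/-! ### Regular local rings are domains -/

section RegularDomain

theorem IsRegularLocalRing.quotient_span_singleton {A : Type*} [CommRing A] [IsRegularLocalRing A]
    {f : A} (hf : f ∈ maximalIdeal A) (hf2 : f ∉ maximalIdeal A ^ 2) :
    IsRegularLocalRing (A ⧸ Ideal.span {f}) ∧
      ringKrullDim A ≤ ringKrullDim (A ⧸ Ideal.span {f}) + 1 ∧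
      ringKrullDim (A ⧸ Ideal.span {f}) + 1 ≤ ringKrullDim A := by
  classical
  obtain ⟨s, hs, hcard⟩ := exists_finset_span_sup_eq_maximalIdeal hf hf2
  have hne : Ideal.span {f} ≠ ⊤ := fun h => by
    have : Ideal.span {f} ≤ maximalIdeal A := by rwa [Ideal.span_singleton_le_iff_mem]
    rw [h, top_le_iff] at this
    exact Ideal.IsPrime.ne_top' this
  have : Nontrivial (A ⧸ Ideal.span {f}) := Ideal.Quotient.nontrivial_iff.mpr hne
  let π := Ideal.Quotient.mk (Ideal.span {f})
  have hπ : Function.Surjective π := Ideal.Quotient.mk_surjective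
  have : IsLocalRing (A ⧸ Ideal.span {f}) := IsLocalRing.of_surjective' π hπ
  have h1 : ringKrullDim A ≤ ringKrullDim (A ⧸ Ideal.span {f}) + 1 := by
    rw [← maximalIdeal_height_eq_ringKrullDim]
    exact Ideal.height_le_ringKrullDim_quotient_add_one hf
  have hspan : maximalIdeal (A ⧸ Ideal.span {f}) =
      Ideal.span ((s.image π : Finset _) : Set (A ⧸ Ideal.span {f})) := by
    rw [← map_maximalIdeal_of_surjective π hπ, ← hs, Ideal.map_sup, Ideal.map_quotient_self,
      bot_sup_eq, Ideal.map_span, Finset.coe_image]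
  have h2 : (maximalIdeal (A ⧸ Ideal.span {f})).spanFinrank ≤ s.card := by
    rw [hspan]
    refine (Submodule.spanFinrank_span_le_ncard_of_finite (Finset.finite_toSet _)).trans ?_
    rw [Set.ncard_coe_finset]
    exact Finset.card_image_le
  have hA := (isRegularLocalRing_iff A).mp inferInstance
  have h3 := ringKrullDim_le_spanFinrank_maximalIdeal (A ⧸ Ideal.span {f})
  have h4 : ((maximalIdeal (A ⧸ Ideal.span {f})).spanFinrank : WithBot ℕ∞) + 1 ≤
      ringKrullDim A := by
    rw [← hA]
    exact_mod_cast (by omega :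
      (maximalIdeal (A ⧸ Ideal.span {f})).spanFinrank + 1 ≤ (maximalIdeal A).spanFinrank)
  refine ⟨IsRegularLocalRing.of_spanFinrank_maximalIdeal_le _ ?_, h1,
    (add_le_add_left h3 1).trans h4⟩
  have h5 := h4.trans h1
  obtain ⟨t, -, ht⟩ := Ideal.exists_finset_card_eq_height_of_isNoetherianRing
    (maximalIdeal (A ⧸ Ideal.span {f}))
  rw [← maximalIdeal_height_eq_ringKrullDim, ← ht] at h5 ⊢
  have h6 : (maximalIdeal (A ⧸ Ideal.span {f})).spanFinrank + 1 ≤ t.card + 1 := by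
    exact_mod_cast h5
  exact_mod_cast Nat.le_of_add_le_add_right h6

/-- Induction on the embedding dimension: prime avoidance gives f ∈ 𝔪 outside 𝔪² and all minimal
primes, A/(f) is a domain by induction, and Nakayama kills a minimal prime contained in (f). -/
theorem IsRegularLocalRing.isDomain_of_spanFinrank_eq (n : ℕ) :
    ∀ (A : Type u) [CommRing A] [IsRegularLocalRing A],
      (maximalIdeal A).spanFinrank = n → IsDomain A := by
  induction n with
  | zero =>
    intro A _ _ h
    have hbot : maximalIdeal A = ⊥ :=
      (Submodule.spanFinrank_eq_zero_iff_eq_bot (IsNoetherian.noetherian _)).mp h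
    have := (isField_iff_maximalIdeal_eq.mpr hbot)
    exact this.isDomain
  | succ n ih =>
    intro A _ _ h
    obtain ⟨f, hf, hf2, hfmin⟩ : ∃ f ∈ maximalIdeal A, f ∉ maximalIdeal A ^ 2 ∧
        ∀ p ∈ minimalPrimes A, f ∉ p := by
      classical
      by_contra! hcon
      have hfin := minimalPrimes.finite_of_isNoetherianRing A
      have hsub : (maximalIdeal A : Set A) ⊆
          ⋃ p ∈ ((insert (maximalIdeal A ^ 2) hfin.toFinset : Finset (Ideal A)) : Set (Ideal A)),
            (p : Set A) := by
        intro f hf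
        simp only [Set.mem_iUnion]
        by_cases hf2 : f ∈ maximalIdeal A ^ 2
        · exact ⟨_, by simp, hf2⟩
        · obtain ⟨p, hp, hfp⟩ := hcon f hf hf2
          exact ⟨p, by simp [hp], hfp⟩
      -- Prime avoidance tolerates the one non-prime ideal 𝔪².
      rw [Ideal.subset_union_prime (f := fun p : Ideal A => p) (maximalIdeal A ^ 2)
        (maximalIdeal A ^ 2) (fun p hp hne _ => by
          rw [Finset.mem_insert, Set.Finite.mem_toFinset] at hp
          exact (hp.resolve_left hne).1.1)] at hsub
      obtain ⟨p, hp, hle⟩ := hsub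
      rw [Finset.mem_insert, Set.Finite.mem_toFinset] at hp
      have hdim := (isRegularLocalRing_iff A).mp inferInstance
      rcases hp with rfl | hp
      · have hbot : maximalIdeal A = ⊥ := by
          refine Submodule.eq_bot_of_le_smul_of_le_jacobson_bot (maximalIdeal A) _
            (IsNoetherian.noetherian _) ?_ (maximalIdeal_le_jacobson _)
          rwa [smul_eq_mul, ← pow_two]
        rw [hbot, Submodule.spanFinrank_bot] at h
        omega
      · have hpm : maximalIdeal A = p := le_antisymm hle (le_maximalIdeal hp.1.1.ne_top)
        have hht : (maximalIdeal A).height = 0 := by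
          rw [Ideal.height_eq_zero_iff, hpm]
          exact hp
        rw [← maximalIdeal_height_eq_ringKrullDim, hht, h] at hdim
        have : n + 1 = 0 := by exact_mod_cast hdim
        omega
    obtain ⟨hreg, hd1, hd2⟩ := IsRegularLocalRing.quotient_span_singleton hf hf2
    have hrank : (maximalIdeal (A ⧸ Ideal.span {f})).spanFinrank = n := by
      have e1 := (isRegularLocalRing_iff A).mp inferInstance
      have e2 := (isRegularLocalRing_iff (A ⧸ Ideal.span {f})).mp inferInstance
      rw [← e1, ← e2, h] at hd1 hd2
      have e3 : n + 1 ≤ (maximalIdeal (A ⧸ Ideal.span {f})).spanFinrank + 1 := by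
        exact_mod_cast hd1
      have e4 : (maximalIdeal (A ⧸ Ideal.span {f})).spanFinrank + 1 ≤ n + 1 := by
        exact_mod_cast hd2
      omega
    have hdom : IsDomain (A ⧸ Ideal.span {f}) := ih _ hrank
    have hfprime : (Ideal.span {f}).IsPrime := (Ideal.Quotient.isDomain_iff_prime _).mp hdom
    obtain ⟨p, hp, hpf⟩ := Ideal.exists_minimalPrimes_le (I := (⊥ : Ideal A))
      (bot_le : ⊥ ≤ Ideal.span {f})
    have hpp : p.IsPrime := hp.1.1
    have hfp : f ∉ p := hfmin p hp
    -- Since p ⊆ (f) and f ∉ p, every x = af in p has a ∈ p; thus p ⊆ 𝔪p.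
    have hpbot : p = ⊥ := by
      refine Submodule.eq_bot_of_le_smul_of_le_jacobson_bot (maximalIdeal A) _
        (IsNoetherian.noetherian _) ?_ (maximalIdeal_le_jacobson _)
      intro x hx
      obtain ⟨a, rfl⟩ := Ideal.mem_span_singleton'.mp (hpf hx)
      have ha : a ∈ p := (hpp.mem_or_mem hx).resolve_right hfp
      rw [mul_comm, smul_eq_mul]
      exact Ideal.mul_mem_mul hf ha
    have : (⊥ : Ideal A).IsPrime := hpbot ▸ hpp
    exact IsDomain.of_bot_isPrime A

theorem IsRegularLocalRing.isDomain (A : Type u) [CommRing A] [IsRegularLocalRing A] :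
    IsDomain A :=
  IsRegularLocalRing.isDomain_of_spanFinrank_eq _ A rfl

theorem IsRegularRing.isReduced (A : Type u) [CommRing A] [IsRegularRing A] : IsReduced A := by
  refine isReduced_ofLocalizationMaximal A fun p hp => ?_
  have := IsRegularLocalRing.isDomain (Localization.AtPrime p)
  infer_instance

end RegularDomain

/-! ### Noetherian completions and nilpotents in flat extensions -/

section Completion

theorem AdicCompletion.exists_surjective_ringHom {P R : Type*} [CommRing P] [CommRing R]
    (φ : P →+* R) (hφ : Function.Surjective φ) (J : Ideal P) :
    ∃ F : AdicCompletion J P →+* AdicCompletion (J.map φ) R, Function.Surjective F := by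
  have hle : ∀ k, J ^ k ≤ (J.map φ ^ k).comap φ := fun k => by
    rw [← Ideal.map_le_iff_le_comap, Ideal.map_pow]
  let F : AdicCompletion J P →+* AdicCompletion (J.map φ) R :=
    AdicCompletion.liftRingHom (J.map φ)
      (fun k => (Ideal.quotientMap (J.map φ ^ k) φ (hle k)).comp
        (AdicCompletion.evalₐ J k : AdicCompletion J P →+* P ⧸ J ^ k)) (by
        intro m n hmn
        ext x
        obtain ⟨a, rfl⟩ := AdicCompletion.mk_surjective J P x
        have h := AdicCompletion.Ideal.mk_eq_mk J hmn a
        have h1 : a.val n - a.val m ∈ J ^ m := Ideal.Quotient.eq.mp h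
        simp only [RingHom.comp_apply, RingHom.coe_coe, AdicCompletion.evalₐ_mk,
          Ideal.quotientMap_mk]
        refine (Ideal.Quotient.eq.mpr ?_ : Ideal.Quotient.mk (J.map φ ^ m) (φ (a.val n)) = _)
        rw [← map_sub]
        exact hle m h1)
  refine ⟨F, fun y => ?_⟩
  obtain ⟨a, rfl⟩ := AdicCompletion.mk_surjective _ _ y
  -- Lifting the successive differences inside J^k, rather than the terms, makes the partial sums a
  -- Cauchy lift.
  have hd : ∀ k, ∃ d ∈ J ^ k, φ d = a.val (k + 1) - a.val k := fun k => by
    have h1 : a.val (k + 1) - a.val k ∈ (J.map φ) ^ k :=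
      Ideal.Quotient.eq.mp (AdicCompletion.Ideal.mk_eq_mk _ (Nat.le_succ k) a)
    rwa [← Ideal.map_pow, Ideal.mem_map_iff_of_surjective φ hφ] at h1
  choose d hdJ hda using hd
  obtain ⟨c, hc⟩ := hφ (a.val 0)
  let b : ℕ → P := fun k => c + ∑ j ∈ Finset.range k, d j
  have hb : ∀ k, φ (b k) = a.val k := fun k => by
    simp only [b, map_add, map_sum, hda, hc]
    rw [Finset.sum_range_sub, add_sub_cancel]
  have hcauchy : ∀ k, b k ≡ b (k + 1) [SMOD (J ^ k • ⊤ : Submodule P P)] := fun k => by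
    rw [SModEq.comm, SModEq.sub_mem]
    simpa [b, Finset.sum_range_succ, ← add_assoc] using hdJ k
  refine ⟨AdicCompletion.mk J P (AdicCompletion.AdicCauchySequence.mk J P b hcauchy), ?_⟩
  refine AdicCompletion.ext_evalₐ fun k => ?_
  rw [AdicCompletion.evalₐ_liftRingHom, AdicCompletion.evalₐ_mk, RingHom.comp_apply,
    RingHom.coe_coe, AdicCompletion.evalₐ_mk, Ideal.quotientMap_mk]
  exact congrArg _ (hb k)

/-- Sending variables to generators of I presents the completion as a quotient of a power series
ring in finitely many variables, the latter being the completion of the polynomial ring. -/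
theorem AdicCompletion.isNoetherianRing {R : Type*} [CommRing R] [IsNoetherianRing R]
    (I : Ideal R) : IsNoetherianRing (AdicCompletion I R) := by
  obtain ⟨n, x, hx⟩ := Submodule.fg_iff_exists_fin_generating_family.mp
    (IsNoetherian.noetherian I)
  let φ : MvPolynomial (Fin n) R →+* R := (MvPolynomial.aeval x : _ →ₐ[R] R)
  have hφ : Function.Surjective φ := fun r => ⟨MvPolynomial.C r, by simp [φ]⟩
  have hmap : (MvPolynomial.idealOfVars (Fin n) R).map φ = I := by
    rw [MvPolynomial.idealOfVars, Ideal.map_span, ← hx, ← Set.range_comp]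
    change Submodule.span R _ = _
    congr 2
    ext i
    simp [φ]
  have hsurj := AdicCompletion.exists_surjective_ringHom φ hφ (MvPolynomial.idealOfVars (Fin n) R)
  rw [hmap] at hsurj
  obtain ⟨F, hF⟩ := hsurj
  have := isNoetherianRing_of_ringEquiv _
    (MvPowerSeries.toAdicCompletionAlgEquiv (Fin n) R).toRingEquiv
  exact isNoetherianRing_of_surjective _ _ F hF

/-- A nilpotent element of a flat algebra with reduced fibres over the minimal primes is in the
extension of the nilradical. -/
theorem mem_map_nilradical_of_isNilpotent {R C : Type u} [CommRing R] [IsNoetherianRing R]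
    [CommRing C] [Algebra R C] [Module.Flat R C]
    (hred : ∀ (p : Ideal R) [p.IsPrime], p ∈ minimalPrimes R → IsReduced (p.Fiber C))
    {g : C} (hg : IsNilpotent g) : g ∈ (nilradical R).map (algebraMap R C) := by
  classical
  have : Fintype (minimalPrimes R) := (minimalPrimes.finite_of_isNoetherianRing R).fintype
  have hprime : ∀ p : minimalPrimes R, p.1.IsPrime := fun p => p.2.1.1
  let ψ₀ : R →ₗ[R] ∀ p : minimalPrimes R, p.1.ResidueField :=
    LinearMap.pi fun p => Algebra.linearMap R p.1.ResidueField
  have hker : LinearMap.ker ψ₀ = nilradical R := by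
    ext x
    rw [nilradical, ← Ideal.sInf_minimalPrimes, Ideal.mem_sInf, LinearMap.mem_ker]
    constructor
    · intro h p hp
      have h1 := congrFun h ⟨p, hp⟩
      exact (@Ideal.algebraMap_residueField_eq_zero _ _ p hp.1.1 x).mp h1
    · intro h
      funext p
      exact Ideal.algebraMap_residueField_eq_zero.mpr (h p.2)
  -- The reduction embeds in the finite product of residue fields at minimal primes. By flatness C ⊗
  -- R_red embeds in the product of the fibres, where the nilpotent g becomes zero.
  let ψ : (R ⧸ nilradical R) →ₗ[R] ∀ p : minimalPrimes R, p.1.ResidueField :=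
    Submodule.liftQ _ ψ₀ hker.ge
  have hψ : Function.Injective ψ := by
    rw [← LinearMap.ker_eq_bot]
    exact Submodule.ker_liftQ_eq_bot _ _ _ hker.le
  have hinj := Module.Flat.lTensor_preserves_injective_linearMap (M := C) ψ hψ
  have hzero : (g ⊗ₜ[R] (1 : R ⧸ nilradical R) : C ⊗[R] (R ⧸ nilradical R)) = 0 := by
    apply hinj
    rw [map_zero, LinearMap.lTensor_tmul]
    apply (TensorProduct.piRight R R C fun p : minimalPrimes R => p.1.ResidueField).injective
    rw [map_zero, TensorProduct.piRight_apply, TensorProduct.piRightHom_tmul]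
    funext p
    have := hred p.1 p.2
    have h1 : ψ 1 p = 1 := map_one (algebraMap R p.1.ResidueField)
    rw [h1]
    have h2 : IsNilpotent (((1 : p.1.ResidueField) ⊗ₜ[R] g : p.1.Fiber C)) :=
      hg.map (Algebra.TensorProduct.includeRight : C →ₐ[R] p.1.ResidueField ⊗[R] C)
    have h3 := h2.eq_zero
    have h4 := congrArg (TensorProduct.comm R p.1.ResidueField C) h3
    rwa [map_zero, TensorProduct.comm_tmul] at h4
  have h5 : algebraMap C (C ⧸ (nilradical R).map (algebraMap R C)) g = 0 := by
    apply (Algebra.TensorProduct.quotIdealMapEquivTensorQuot C (nilradical R)).injective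
    rw [map_zero, AlgEquiv.commutes]
    exact hzero
  exact Ideal.Quotient.eq_zero_iff_mem.mp h5

end Completion

/-! ### Descending chains of ideals modulo powers of 𝔪 -/

section Chevalley

variable {R : Type*} [CommRing R] [IsLocalRing R] [IsNoetherianRing R]

theorem exists_forall_sup_maximalIdeal_pow_eq {J : ℕ → Ideal R} (hJ : Antitone J) {k : ℕ}
    (hk : k ≠ 0) :
    ∃ n₀, ∀ n, n₀ ≤ n → J n ⊔ maximalIdeal R ^ k = J n₀ ⊔ maximalIdeal R ^ k := by
  let π := Ideal.Quotient.mk (maximalIdeal R ^ k)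
  have hπ : Function.Surjective π := Ideal.Quotient.mk_surjective
  have hne : maximalIdeal R ^ k ≠ ⊤ := fun h =>
    Ideal.IsPrime.ne_top' (top_le_iff.mp (h ▸ Ideal.pow_le_self hk : ⊤ ≤ maximalIdeal R))
  have : Nontrivial (R ⧸ maximalIdeal R ^ k) := Ideal.Quotient.nontrivial_iff.mpr hne
  have : IsLocalRing (R ⧸ maximalIdeal R ^ k) := IsLocalRing.of_surjective' π hπ
  have : IsArtinianRing (R ⧸ maximalIdeal R ^ k) := by
    rw [isArtinianRing_iff_isNilpotent_maximalIdeal]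
    refine ⟨k, ?_⟩
    rw [← map_maximalIdeal_of_surjective π hπ, ← Ideal.map_pow, Ideal.map_quotient_self]
    rfl
  obtain ⟨n₀, hn₀⟩ := IsArtinian.monotone_stabilizes
    (⟨fun n => OrderDual.toDual ((J n).map π), fun a b hab => Ideal.map_mono (hJ hab)⟩ :
      ℕ →o (Ideal (R ⧸ maximalIdeal R ^ k))ᵒᵈ)
  refine ⟨n₀, fun n hn => ?_⟩
  have h1 : (J n₀).map π = (J n).map π := hn₀ n hn
  have h2 := congrArg (Ideal.comap π) h1
  rw [Ideal.comap_map_of_surjective π hπ, Ideal.comap_map_of_surjective π hπ,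
    ← RingHom.ker_eq_comap_bot, Ideal.mk_ker] at h2
  exact h2.symm

/-- The Mittag-Leffler argument in Chevalley's theorem: a descending chain of ideals none of which
is contained in `T` contains up to higher and higher powers of `𝔪` the terms of a Cauchy
sequence with limit outside `T`. -/
theorem exists_cauchy_of_forall_not_le {J : ℕ → Ideal R} (hJ : Antitone J) {T : Ideal R}
    (hJT : ∀ n, ¬ J n ≤ T) :
    ∃ a : ℕ → R, a 0 ∉ T ∧ (∀ k, a (k + 1) - a k ∈ maximalIdeal R ^ (k + 2)) ∧
      ∀ k n, a k ∈ J n ⊔ maximalIdeal R ^ (k + 2) := by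
  -- The chain stabilises in the Artinian ring R/𝔪^(k+2), say from N k on. The exponent starts at 2
  -- so that all terms agree with the first modulo 𝔪².
  have hstab := fun k : ℕ => exists_forall_sup_maximalIdeal_pow_eq hJ (k + 1).succ_ne_zero
  choose N hN using hstab
  have hmem : ∀ k x, x ∈ J (N k) ⊔ maximalIdeal R ^ (k + 2) →
      ∀ n, x ∈ J n ⊔ maximalIdeal R ^ (k + 2) := fun k x hx n => by
    have h1 := hN k (max n (N k)) (le_max_right _ _)
    rw [← h1] at hx
    exact sup_le_sup_right (hJ (le_max_left _ _)) _ hx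
  have hstep : ∀ k x, (∀ n, x ∈ J n ⊔ maximalIdeal R ^ (k + 2)) →
      ∃ y, (∀ n, y ∈ J n ⊔ maximalIdeal R ^ (k + 1 + 2)) ∧ y - x ∈ maximalIdeal R ^ (k + 2) := by
    intro k x hx
    -- The component y in J (N (k + 1)) is the next term: stabilisation places it in every J n +
    -- 𝔪^(k+3).
    obtain ⟨y, hy, z, hz, hyz⟩ := Submodule.mem_sup.mp (hx (N (k + 1)))
    refine ⟨y, hmem (k + 1) y (Ideal.mem_sup_left hy), ?_⟩
    rw [← hyz, sub_add_cancel_left]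
    exact Ideal.neg_mem_iff _ |>.mpr hz
  obtain ⟨x₀, hx₀, hx₀T⟩ := SetLike.not_le_iff_exists.mp (hJT (N 0))
  choose! next hnext hsub using hstep
  let a : ℕ → R := fun k => Nat.rec x₀ (fun k x => next k x) k
  have ha : ∀ k n, a k ∈ J n ⊔ maximalIdeal R ^ (k + 2) := by
    intro k
    induction k with
    | zero => exact hmem 0 x₀ (Ideal.mem_sup_left hx₀)
    | succ k ih => exact hnext k (a k) ih
  exact ⟨a, hx₀T, fun k => hsub k (a k) (ha k), ha⟩

end Chevalley

/-! ### Reduced formal fibres bound ν̄ modulo 𝔪² and nilpotents -/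

section FormalFibres

/-- If every 𝔪^{≥n} escaped 𝔪² + Nil(R), the Chevalley argument would yield a limit g in the
completion with ν̄(g) = ∞. Then g is nilpotent, so it lies in the extension of Nil(R), and reducing
modulo 𝔪² puts the first term of the sequence in 𝔪² + Nil(R). -/
theorem exists_samuelGe_le_of_isReduced_fiber {R : Type u} [CommRing R] [IsLocalRing R]
    [IsNoetherianRing R]
    (hred : ∀ (p : Ideal R) [p.IsPrime], p ∈ minimalPrimes R →
      IsReduced (p.Fiber (AdicCompletion (maximalIdeal R) R))) :
    ∃ n : ℕ, samuelGe (maximalIdeal R) n ≤ maximalIdeal R ^ 2 ⊔ nilradical R := by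
  by_contra! hcon
  have hanti : Antitone fun n : ℕ => samuelGe (maximalIdeal R) (n : ℝ≥0∞) := fun a b hab =>
    samuelGe_anti _ (by exact_mod_cast hab)
  obtain ⟨a, ha0, hsub, ha⟩ := exists_cauchy_of_forall_not_le hanti hcon
  set m := maximalIdeal R with hm
  let C := AdicCompletion m R
  have hC : IsNoetherianRing C := AdicCompletion.isNoetherianRing m
  have hfg : m.FG := IsNoetherian.noetherian m
  have hcauchy : ∀ k, a k ≡ a (k + 1) [SMOD (m ^ k • ⊤ : Submodule R R)] := fun k => by
    rw [SModEq.comm, SModEq.sub_mem, smul_eq_mul, Ideal.mul_top]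
    exact Ideal.pow_le_pow_right (by omega) (hsub k)
  let g : C := AdicCompletion.mk m R (AdicCompletion.AdicCauchySequence.mk m R a hcauchy)
  have hmap : m.map (algebraMap R C) = maximalIdeal C :=
    AdicCompletion.maximalIdeal_eq_map.symm
  have hg : ∀ k, g - algebraMap R C (a k) ∈ maximalIdeal C ^ k := fun k => by
    rw [← hmap, ← Ideal.map_pow, ← Submodule.restrictScalars_mem R, ← Ideal.smul_top_eq_map,
      AdicCompletion.pow_smul_top_eq_ker_eval hfg, LinearMap.mem_ker, map_sub, sub_eq_zero]
    rfl
  have hgtop : asymptoticSamuel (maximalIdeal C) g = ⊤ := by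
    refine ENNReal.eq_top_of_forall_nnreal_le fun r => ?_
    obtain ⟨n, hn⟩ := exists_nat_ge r
    refine le_trans (by exact_mod_cast hn : (r : ℝ≥0∞) ≤ n) ?_
    -- a n is a sum of an element of 𝔪^{≥n} and one of 𝔪^(n+2); moreover g - a n lies in the n-th
    -- power of the maximal ideal of C.
    have h1 : (n : ℝ≥0∞) ≤ asymptoticSamuel m (a n) := by
      obtain ⟨y, hy, z, hz, hyz⟩ := Submodule.mem_sup.mp (ha n n)
      rw [← hyz]
      refine (le_min hy ?_).trans (asymptoticSamuel_add m y z)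
      exact le_asymptoticSamuel_of_mem (Ideal.pow_le_pow_right (by omega) hz)
    have h2 := h1.trans (asymptoticSamuel_le_map (algebraMap R C) hmap.le (a n))
    have h3 := (le_min h2 (le_asymptoticSamuel_of_mem (hg n))).trans
      (asymptoticSamuel_add _ _ _)
    rwa [add_sub_cancel] at h3
  have hflat : Module.Flat R C := AdicCompletion.flat_of_isNoetherian m
  have hmemN := mem_map_nilradical_of_isNilpotent hred
    (isNilpotent_of_asymptoticSamuel_eq_top hgtop)
  have hN : (nilradical R).map (algebraMap R C) ≤
      ((nilradical R).map (Ideal.Quotient.mk (m ^ 2))).comap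
        (AdicCompletion.evalₐ m 2 : C →+* R ⧸ m ^ 2) := by
    rw [Ideal.map_le_iff_le_comap]
    intro x hx
    have h1 : (AdicCompletion.evalₐ m 2 : C →+* R ⧸ m ^ 2) (algebraMap R C x) =
        Ideal.Quotient.mk (m ^ 2) x := AdicCompletion.evalₐ_of m 2 x
    rw [Ideal.mem_comap, Ideal.mem_comap, h1]
    exact Ideal.mem_map_of_mem _ hx
  have h1 : Ideal.Quotient.mk (m ^ 2) (a 2) ∈ (nilradical R).map (Ideal.Quotient.mk (m ^ 2)) := by
    have h := hN hmemN
    rw [Ideal.mem_comap] at h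
    have h' : (AdicCompletion.evalₐ m 2 : C →+* R ⧸ m ^ 2) g = Ideal.Quotient.mk (m ^ 2) (a 2) :=
      AdicCompletion.evalₐ_mk m 2 _
    rwa [h'] at h
  have h2 : a 2 ∈ m ^ 2 ⊔ nilradical R := by
    have h := Ideal.mem_comap.mpr h1
    rwa [Ideal.comap_map_of_surjective _ Ideal.Quotient.mk_surjective, ← RingHom.ker_eq_comap_bot,
      Ideal.mk_ker, sup_comm] at h
  have h3 : a 2 - a 0 ∈ m ^ 2 := by
    rw [← sub_add_sub_cancel (a 2) (a 1) (a 0)]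
    exact (m ^ 2).add_mem (Ideal.pow_le_pow_right (by omega) (hsub 1)) (hsub 0)
  refine ha0 ?_
  rw [← sub_sub_self (a 2) (a 0)]
  exact Ideal.sub_mem _ h2 (Ideal.mem_sup_left h3)

theorem exists_samuelGe_le_of_isGRing {B : Type u} [CommRing B] [IsLocalRing B] (hG : IsGRing B) :
    ∃ n : ℕ, samuelGe (maximalIdeal B) n ≤ maximalIdeal B ^ 2 ⊔ nilradical B := by
  have hnoeth := hG.1
  let R := Localization.AtPrime (maximalIdeal B)
  have hR : IsNoetherianRing R :=
    IsLocalization.isNoetherianRing (maximalIdeal B).primeCompl R hnoeth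
  let e : B ≃ₐ[B] R :=
    IsLocalization.atUnits B (maximalIdeal B).primeCompl (fun x ↦ by simpa using! fun a ↦ a)
  obtain ⟨n, hn⟩ := exists_samuelGe_le_of_isReduced_fiber (R := R) fun p _ _ => by
    -- Geometric regularity is used only for the trivial extension of the residue field, at the
    -- localization of B at 𝔪, which is B again.
    have h : IsRegularRing
        (p.ResidueField ⊗[p.ResidueField] p.Fiber (AdicCompletion (maximalIdeal R) R)) :=
      hG.2 (maximalIdeal B) p p.ResidueField
    have h1 := IsRegularRing.isReduced
      (p.ResidueField ⊗[p.ResidueField] p.Fiber (AdicCompletion (maximalIdeal R) R))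
    exact isReduced_of_injective _ (Algebra.TensorProduct.lid p.ResidueField
        (p.Fiber (AdicCompletion (maximalIdeal R) R))).symm.injective
  have hm : (maximalIdeal B).map (e : B →+* R) = maximalIdeal R :=
    map_maximalIdeal_of_surjective _ e.surjective
  refine ⟨n, fun f hf => ?_⟩
  have h1 : e f ∈ samuelGe (maximalIdeal R) n :=
    le_trans hf (asymptoticSamuel_le_map (e : B →+* R) hm.le f)
  obtain ⟨y, hy, z, hz, hyz⟩ := Submodule.mem_sup.mp (hn h1)
  rw [← hm, ← Ideal.map_pow, Ideal.mem_map_iff_of_surjective (e : B →+* R) e.surjective] at hy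
  obtain ⟨y', hy', rfl⟩ := hy
  obtain ⟨z', rfl⟩ := e.surjective z
  have hz' : z' ∈ nilradical B := by
    rw [mem_nilradical] at hz ⊢
    exact (IsNilpotent.map_iff e.injective).mp hz
  have h2 : f = y' + z' := e.injective (by rw [map_add]; exact hyz.symm)
  rw [h2]
  exact Submodule.add_mem_sup hy' hz'

end FormalFibres

/-! ### The slope without reference to λ-sequences -/

section SlopeOfLocalRing

variable {A : Type*} [CommRing A] [IsLocalRing A]

theorem toCotangent_mem_samuelKer {x : maximalIdeal A} :
    ((maximalIdeal A).toCotangent x : CotangentSpace A) ∈ samuelKer A ↔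
      (x : A) ∈ samuelGt (maximalIdeal A) 1 :=
  samuelClass_eq_zero_iff (maximalIdeal A) x

theorem samuelGt_le_maximalIdeal (r : NNReal) : samuelGt (maximalIdeal A) r ≤ maximalIdeal A :=
  fun _ hf => mem_of_asymptoticSamuel_pos (bot_le.trans_lt hf)

theorem samuelKer_eq_bot_of_le (h : samuelGt (maximalIdeal A) 1 ≤ maximalIdeal A ^ 2) :
    samuelKer A = ⊥ := by
  refine eq_bot_iff.mpr fun x hx => ?_
  obtain ⟨y, rfl⟩ := Ideal.toCotangent_surjective _ x
  exact (Ideal.toCotangent_eq_zero _ _).mpr (h (toCotangent_mem_samuelKer.mp hx))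

variable [IsNoetherianRing A]

/-- Modulo 𝔪², all of ker λ is represented in the ideal 𝔪^{≥r} exactly when some basis of it is. The
right side mentions only ideals, so it can be compared between B and B_red, whose t may differ. -/
theorem iSup_isLambdaSequence_eq_sSup
    (hext : Module.finrank (ResidueField A) (samuelKer A) = excEmbDim A) :
    (⨆ (γ : Fin (excEmbDim A) → maximalIdeal A) (_ : IsLambdaSequence A γ),
      ⨅ i, asymptoticSamuel (maximalIdeal A) (γ i : A)) =
    sSup {r : ℝ≥0∞ | samuelGt (maximalIdeal A) 1 ≤
      samuelGe (maximalIdeal A) r ⊔ maximalIdeal A ^ 2} := by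
  set m := maximalIdeal A with hm
  refine le_antisymm (iSup₂_le fun γ hγ => le_sSup ?_) (sSup_le fun r hr => ?_)
  · set r := ⨅ i, asymptoticSamuel m (γ i : A)
    have hle : ∀ y ∈ Submodule.span (ResidueField A)
        (Set.range fun i => (m.toCotangent (γ i) : CotangentSpace A)),
        ∃ z : m, (z : A) ∈ samuelGe m r ∧ m.toCotangent z = y := by
      intro y hy
      induction hy using Submodule.span_induction with
      | mem y hy =>
        obtain ⟨i, rfl⟩ := hy
        exact ⟨γ i, iInf_le (fun i => asymptoticSamuel m (γ i : A)) i, rfl⟩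
      | zero => exact ⟨0, zero_mem _, map_zero _⟩
      | add x y _ _ hx hy =>
        obtain ⟨z, hz, rfl⟩ := hx
        obtain ⟨w, hw, rfl⟩ := hy
        exact ⟨z + w, add_mem hz hw, map_add _ _ _⟩
      | smul c x _ hx =>
        obtain ⟨z, hz, rfl⟩ := hx
        obtain ⟨b, rfl⟩ := residue_surjective (R := A) c
        exact ⟨b • z, Ideal.mul_mem_left _ _ hz, map_smul _ _ _⟩
    intro f hf
    obtain ⟨z, hz, hzf⟩ := hle (m.toCotangent ⟨f, samuelGt_le_maximalIdeal 1 hf⟩)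
      (hγ.2 ▸ toCotangent_mem_samuelKer.mpr hf)
    have h1 : f - z ∈ m ^ 2 := (Ideal.toCotangent_eq _).mp hzf.symm
    rw [← add_sub_cancel (z : A) f]
    exact Submodule.add_mem_sup hz h1
  · have hrep : ∀ x ∈ samuelKer A, ∃ z : m, (z : A) ∈ samuelGe m r ∧ m.toCotangent z = x := by
      intro x hx
      obtain ⟨f, rfl⟩ := Ideal.toCotangent_surjective _ x
      have hf := toCotangent_mem_samuelKer.mp hx
      obtain ⟨z, hz, w, hw, hzw⟩ := Submodule.mem_sup.mp (hr hf)
      have hzm : z ∈ m := by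
        rw [← add_sub_cancel_right z w, hzw]
        exact sub_mem f.2 (Ideal.pow_le_self two_ne_zero hw)
      refine ⟨⟨z, hzm⟩, hz, (Ideal.toCotangent_eq _).mpr ?_⟩
      rw [← hzw, sub_add_cancel_left]
      exact neg_mem hw
    let b := Module.finBasisOfFinrankEq (ResidueField A) (samuelKer A) hext
    choose γ hγ hγb using fun i => hrep (b i) (b i).2
    have hfun : (fun i => (m.toCotangent (γ i) : CotangentSpace A)) =
        (samuelKer A).subtype ∘ b := funext hγb
    have hlam : IsLambdaSequence A γ := by
      constructor
      · rw [hfun]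
        exact b.linearIndependent.map' _ (Submodule.ker_subtype _)
      · rw [hfun, Set.range_comp, ← Submodule.map_span, b.span_eq, Submodule.map_subtype_top]
    exact le_iSup₂_of_le γ hlam (le_iInf hγ)

theorem toNat_ringKrullDim_le_finrank_cotangentSpace :
    ((ringKrullDim A).unbotD 0).toNat ≤ Module.finrank (ResidueField A) (CotangentSpace A) := by
  have h := ringKrullDim_le_spanFinrank_maximalIdeal A
  rw [spanFinrank_maximalIdeal_eq_finrank_cotangentSpace, ← maximalIdeal_height_eq_ringKrullDim]
    at h
  have h1 : (maximalIdeal A).height ≤ (Module.finrank (ResidueField A) (CotangentSpace A) : ℕ∞) :=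
    by exact_mod_cast h
  rw [← maximalIdeal_height_eq_ringKrullDim, WithBot.unbotD_coe]
  exact ENat.toNat_le_of_le_natCast h1

/-- Passing to the quotient by ker λ trades two numbers that may change under reduction for two that
do not. -/
theorem finrank_samuelKer_eq_excEmbDim_iff :
    Module.finrank (ResidueField A) (samuelKer A) = excEmbDim A ↔
      Module.finrank (ResidueField A) (CotangentSpace A ⧸ samuelKer A) =
        ((ringKrullDim A).unbotD 0).toNat := by
  have h1 := Submodule.finrank_quotient_add_finrank (samuelKer A)
  have h2 := toNat_ringKrullDim_le_finrank_cotangentSpace (A := A)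
  unfold excEmbDim
  omega

theorem isRegularLocalRing_iff_excEmbDim_eq_zero : IsRegularLocalRing A ↔ excEmbDim A = 0 := by
  have h2 := toNat_ringKrullDim_le_finrank_cotangentSpace (A := A)
  obtain ⟨t, -, ht⟩ := Ideal.exists_finset_card_eq_height_of_isNoetherianRing (maximalIdeal A)
  rw [IsRegularLocalRing.iff_finrank_cotangentSpace]
  unfold excEmbDim
  rw [← maximalIdeal_height_eq_ringKrullDim, ← ht] at h2 ⊢
  have h3 : (((t.card : ℕ∞) : WithBot ℕ∞).unbotD 0).toNat = t.card := by simp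
  rw [h3] at h2 ⊢
  constructor
  · intro h
    have : Module.finrank (ResidueField A) (CotangentSpace A) = t.card := by exact_mod_cast h
    omega
  · intro h
    have : Module.finrank (ResidueField A) (CotangentSpace A) = t.card := by omega
    exact_mod_cast this

/-- The inclusion makes ker λ zero, so in the extremal case t = 0. -/
theorem isRegularLocalRing_iff_samuelGt_one_le :
    IsRegularLocalRing A ↔ Module.finrank (ResidueField A) (samuelKer A) = excEmbDim A ∧
      samuelGt (maximalIdeal A) 1 ≤ maximalIdeal A ^ 2 := by
  refine ⟨fun h => ?_, fun ⟨h1, h2⟩ => ?_⟩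
  · have h1 := samuelGt_one_le_sq_of_isRegularLocalRing (A := A)
    refine ⟨?_, h1⟩
    rw [isRegularLocalRing_iff_excEmbDim_eq_zero.mp h, samuelKer_eq_bot_of_le h1, finrank_bot]
  · rw [isRegularLocalRing_iff_excEmbDim_eq_zero, ← h1, samuelKer_eq_bot_of_le h2, finrank_bot]

end SlopeOfLocalRing

/-! ### Comparison of B with B_red -/

section Reduction

variable (B : Type u) [CommRing B] [IsLocalRing B]

theorem ringKrullDim_quotient_nilradical (B : Type*) [CommRing B] :
    ringKrullDim (B ⧸ nilradical B) = ringKrullDim B := by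
  have h : PrimeSpectrum.zeroLocus (nilradical B : Set B) = Set.univ :=
    Set.eq_univ_of_forall fun p => nilradical_le_prime p.asIdeal
  rw [ringKrullDim_quotient, h]
  exact Order.krullDim_eq_of_orderIso OrderIso.Set.univ

theorem map_mk_nilradical_maximalIdeal :
    (maximalIdeal B).map (Ideal.Quotient.mk (nilradical B)) =
      maximalIdeal (B ⧸ nilradical B) :=
  map_maximalIdeal_of_surjective _ Ideal.Quotient.mk_surjective

variable {B}

theorem asymptoticSamuel_mk_nilradical (f : B) :
    asymptoticSamuel (maximalIdeal (B ⧸ nilradical B)) (Ideal.Quotient.mk (nilradical B) f) =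
      asymptoticSamuel (maximalIdeal B) f := by
  rw [← map_mk_nilradical_maximalIdeal]
  exact asymptoticSamuel_of_surjective _ Ideal.Quotient.mk_surjective
    (Ideal.mk_ker (I := nilradical B)).le _ f

theorem samuelGt_one_le_iff_of_nilradical (r : ℝ≥0∞) :
    samuelGt (maximalIdeal (B ⧸ nilradical B)) 1 ≤
        samuelGe (maximalIdeal (B ⧸ nilradical B)) r ⊔ maximalIdeal (B ⧸ nilradical B) ^ 2 ↔
      samuelGt (maximalIdeal B) 1 ≤ samuelGe (maximalIdeal B) r ⊔ maximalIdeal B ^ 2 := by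
  have hπ : Function.Surjective (Ideal.Quotient.mk (nilradical B)) := Ideal.Quotient.mk_surjective
  constructor
  · intro h f hf
    have hf' : Ideal.Quotient.mk (nilradical B) f ∈
        samuelGt (maximalIdeal (B ⧸ nilradical B)) 1 := by
      rwa [mem_samuelGt, asymptoticSamuel_mk_nilradical]
    obtain ⟨y, hy, z, hz, hyz⟩ := Submodule.mem_sup.mp (h hf')
    rw [← map_mk_nilradical_maximalIdeal, ← Ideal.map_pow,
      Ideal.mem_map_iff_of_surjective _ hπ] at hz
    obtain ⟨w, hw, rfl⟩ := hz
    -- Only the 𝔪²-part is lifted; the rest, f - w, has the same ν̄ as its image y.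
    have h1 : f - w ∈ samuelGe (maximalIdeal B) r := by
      rw [mem_samuelGe, ← asymptoticSamuel_mk_nilradical, map_sub, ← hyz, add_sub_cancel_right]
      exact hy
    rw [← sub_add_cancel f w]
    exact Submodule.add_mem_sup h1 hw
  · intro h g hg
    obtain ⟨f, rfl⟩ := hπ g
    rw [mem_samuelGt, asymptoticSamuel_mk_nilradical] at hg
    obtain ⟨y, hy, z, hz, rfl⟩ := Submodule.mem_sup.mp (h hg)
    rw [map_add]
    refine Submodule.add_mem_sup ?_ ?_
    · rwa [mem_samuelGe, asymptoticSamuel_mk_nilradical]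
    · rw [← map_mk_nilradical_maximalIdeal, ← Ideal.map_pow]
      exact Ideal.mem_map_of_mem _ hz

theorem finrank_quotient_samuelKer_eq_of_surjective {A : Type u} [CommRing A] [IsLocalRing A]
    [Algebra B A] (hπ : Function.Surjective (algebraMap B A))
    (hν : ∀ f, asymptoticSamuel (maximalIdeal A) (algebraMap B A f) =
      asymptoticSamuel (maximalIdeal B) f) :
    Module.finrank (ResidueField A) (CotangentSpace A ⧸ samuelKer A) =
      Module.finrank (ResidueField B) (CotangentSpace B ⧸ samuelKer B) := by
  have hloc : IsLocalHom (algebraMap B A) := hπ.isLocalHom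
  have hmap : (maximalIdeal B).map (algebraMap B A) = maximalIdeal A :=
    map_maximalIdeal_of_surjective _ hπ
  let σ : ResidueField B →+* ResidueField A := ResidueField.map (algebraMap B A)
  have hσ : ∀ b, σ (residue B b) = residue A (algebraMap B A b) :=
    fun b => ResidueField.map_residue _ b
  have hσb : Function.Bijective σ := by
    refine ⟨σ.injective, fun y => ?_⟩
    obtain ⟨a, rfl⟩ := residue_surjective y
    obtain ⟨b, rfl⟩ := hπ a
    exact ⟨residue B b, hσ b⟩
  have hle : maximalIdeal B ≤ (maximalIdeal A).comap (Algebra.ofId B A) :=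
    Ideal.map_le_iff_le_comap.mp hmap.le
  let T := Ideal.mapCotangent (maximalIdeal B) (maximalIdeal A) (Algebra.ofId B A) hle
  have hT : ∀ x : maximalIdeal B, T ((maximalIdeal B).toCotangent x) =
      (maximalIdeal A).toCotangent ⟨algebraMap B A x, hle x.2⟩ :=
    fun x => Ideal.mapCotangent_toCotangent _ _ _ _ x
  -- The two residue fields are isomorphic but not equal, hence a σ-semilinear map.
  let g : CotangentSpace B →ₛₗ[σ] CotangentSpace A :=
    { toFun := T
      map_add' := map_add T
      map_smul' := fun c x => by
        obtain ⟨b, rfl⟩ := residue_surjective (R := B) c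
        obtain ⟨y, rfl⟩ := Ideal.toCotangent_surjective _ x
        have e1 : residue B b • (maximalIdeal B).toCotangent y =
            (maximalIdeal B).toCotangent (b • y) := rfl
        have e2 : ∀ (a : A) (z : maximalIdeal A), residue A a • (maximalIdeal A).toCotangent z =
            (maximalIdeal A).toCotangent (a • z) := fun _ _ => rfl
        rw [hσ, hT, e1, hT, e2]
        congr 1
        exact Subtype.ext (map_mul (algebraMap B A) b y) }
  have hg : ∀ x, g x = T x := fun _ => rfl
  let q := (samuelKer A).mkQ.comp g
  have hq : ∀ x, q x = 0 ↔ x ∈ samuelKer B := fun x => by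
    obtain ⟨y, rfl⟩ := Ideal.toCotangent_surjective _ x
    rw [LinearMap.comp_apply, hg, hT, Submodule.mkQ_apply, Submodule.Quotient.mk_eq_zero,
      toCotangent_mem_samuelKer, toCotangent_mem_samuelKer, mem_samuelGt, mem_samuelGt, hν]
  have hqs : Function.Surjective q := fun y => by
    obtain ⟨y, rfl⟩ := Submodule.Quotient.mk_surjective _ y
    obtain ⟨⟨z, hz⟩, rfl⟩ := Ideal.toCotangent_surjective _ y
    obtain ⟨x, hx, hxz⟩ := (Ideal.mem_map_iff_of_surjective _ hπ).mp (hmap.symm ▸ hz)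
    refine ⟨(maximalIdeal B).toCotangent ⟨x, hx⟩, ?_⟩
    rw [LinearMap.comp_apply, hg, hT, Submodule.mkQ_apply]
    congr 2
    exact Subtype.ext hxz
  let Q : (CotangentSpace B ⧸ samuelKer B) →ₛₗ[σ] (CotangentSpace A ⧸ samuelKer A) :=
    (samuelKer B).liftQ q fun x hx => (hq x).mpr hx
  have hQ : Function.Bijective Q := by
    constructor
    · rw [← LinearMap.ker_eq_bot]
      exact Submodule.ker_liftQ_eq_bot _ _ _ fun x hx => (hq x).mp hx
    · intro y
      obtain ⟨x, hx⟩ := hqs y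
      exact ⟨Submodule.Quotient.mk x, hx⟩
  exact (congrArg Cardinal.toNat (rank_eq_of_equiv_equiv σ
    (AddEquiv.ofBijective Q hQ) hσb fun c x => Q.map_smulₛₗ c x)).symm

theorem finrank_samuelKer_nilradical_eq_excEmbDim_iff [IsNoetherianRing B] :
    Module.finrank (ResidueField (B ⧸ nilradical B)) (samuelKer (B ⧸ nilradical B)) =
        excEmbDim (B ⧸ nilradical B) ↔
      Module.finrank (ResidueField B) (samuelKer B) = excEmbDim B := by
  have h := finrank_quotient_samuelKer_eq_of_surjective (A := B ⧸ nilradical B)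
    Ideal.Quotient.mk_surjective fun f => asymptoticSamuel_mk_nilradical f
  rw [finrank_samuelKer_eq_excEmbDim_iff, finrank_samuelKer_eq_excEmbDim_iff, h,
    ringKrullDim_quotient_nilradical]

theorem sSup_samuelGt_one_le_ne_top_of_isGRing (hG : IsGRing B)
    (hext : Module.finrank (ResidueField (B ⧸ nilradical B)) (samuelKer (B ⧸ nilradical B)) =
      excEmbDim (B ⧸ nilradical B))
    (hreg : ¬ IsRegularLocalRing (B ⧸ nilradical B)) :
    sSup {r : ℝ≥0∞ | samuelGt (maximalIdeal (B ⧸ nilradical B)) 1 ≤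
      samuelGe (maximalIdeal (B ⧸ nilradical B)) r ⊔ maximalIdeal (B ⧸ nilradical B) ^ 2} ≠ ⊤ := by
  have hB : IsNoetherianRing B := hG.1
  obtain ⟨n, hn⟩ := exists_samuelGe_le_of_isGRing hG
  have hnA : samuelGe (maximalIdeal (B ⧸ nilradical B)) n ≤
      maximalIdeal (B ⧸ nilradical B) ^ 2 := by
    intro g hg
    obtain ⟨f, rfl⟩ := Ideal.Quotient.mk_surjective g
    rw [mem_samuelGe, asymptoticSamuel_mk_nilradical] at hg
    have h := Ideal.mem_map_of_mem (Ideal.Quotient.mk (nilradical B)) (hn hg)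
    rwa [Ideal.map_sup, Ideal.map_quotient_self, sup_bot_eq, Ideal.map_pow,
      map_mk_nilradical_maximalIdeal] at h
  refine ne_top_of_le_ne_top (ENNReal.natCast_ne_top n) (sSup_le fun r hr => ?_)
  -- For r > n the inclusion 𝔪^{≥r} ⊆ 𝔪^{≥n} ⊆ 𝔪² turns admissibility of r into 𝔪^{>1} ⊆ 𝔪², hence
  -- regularity.
  by_contra! hlt
  exact hreg (isRegularLocalRing_iff_samuelGt_one_le.mpr
    ⟨hext, hr.trans (sup_le ((samuelGe_anti _ hlt.le).trans hnA) le_rfl)⟩)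

end Reduction

/-! ### The main theorem -/

theorem theorem4p6 (B : Type u) [CommRing B] [IsLocalRing B] (hexc : IsExcellentRing B)
    (hequichar : IsEquicharacteristic B) (hequidim : IsEquidimensional B)
    (hnred : ¬ IsReduced B) :
    samuelSlope B = samuelSlope (B ⧸ nilradical B) ∧
      (samuelSlope B = ⊤ ↔ IsRegularLocalRing (B ⧸ nilradical B)) := by
  have hB : IsNoetherianRing B := hexc.isNoetherianRing
  have hBreg : ¬ IsRegularLocalRing B := fun h =>
    hnred (have := IsRegularLocalRing.isDomain B; inferInstance)
  have hext := finrank_samuelKer_nilradical_eq_excEmbDim_iff (B := B)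
  have hset := Set.ext fun r => samuelGt_one_le_iff_of_nilradical (B := B) r
  by_cases hreg : IsRegularLocalRing (B ⧸ nilradical B)
  · obtain ⟨h1, h2⟩ := isRegularLocalRing_iff_samuelGt_one_le.mp hreg
    have hslope : samuelSlope B = ⊤ := by
      rw [samuelSlope, if_neg hBreg, if_pos (hext.mp h1),
        iSup_isLambdaSequence_eq_sSup (hext.mp h1), ← top_le_iff]
      -- Here r = ∞ is itself admissible for B_red, hence for B.
      exact le_sSup ((samuelGt_one_le_iff_of_nilradical ⊤).mp (h2.trans le_sup_right))
    refine ⟨?_, iff_of_true hslope hreg⟩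
    rw [hslope, samuelSlope, if_pos hreg]
  · have heq : samuelSlope B = samuelSlope (B ⧸ nilradical B) := by
      rw [samuelSlope, samuelSlope, if_neg hBreg, if_neg hreg]
      by_cases h1 : Module.finrank (ResidueField B) (samuelKer B) = excEmbDim B
      · rw [if_pos h1, if_pos (hext.mpr h1), iSup_isLambdaSequence_eq_sSup h1,
          iSup_isLambdaSequence_eq_sSup (hext.mpr h1)]
        exact congrArg sSup hset.symm
      · rw [if_neg h1, if_neg (hext.not.mpr h1)]
    refine ⟨heq, iff_of_false ?_ hreg⟩
    rw [heq, samuelSlope, if_neg hreg]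
    split_ifs with h1
    · rw [iSup_isLambdaSequence_eq_sSup h1]
      exact sSup_samuelGt_one_le_ne_top_of_isGRing hexc.gRing h1 hreg
    · exact ENNReal.one_ne_top
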